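/- **Theorem 3.2.** For every $d$ there is a constant $C_M>0$, and for every $D$ there is a threshold $M_0>0$, such that the following holds. Let $k\ge 1$ and let $\mathcal M\subset\mathbb R^D$ be a compact $d$-dimensional $C^k$ submanifold without boundary, of finite reach $\tau$ (the supremum of the $t$ such that every $x$ with $\operatorname{dist}(x,\mathcal M)\le t$ has a unique nearest point $P_{\mathcal M}(x)$ in $\mathcal M$). Let $\sigma>0$, put $M=\tau/\sigma$ and assume $M\ge M_0$. Let $\mathcal M_\sigma=\{x\in\mathbb R^D:\operatorname{dist}(x,\mathcal M)<\sigma\}$, and let $r_1,\dots,r_n$ be independent samples from the uniform distribution (normalised Lebesgue measure) on $\mathcal M_\sigma$. For $r\in\mathcal M_\sigma$, $q\in\mathbb R^D$ and a $d$-dimensional linear subspace $H\subset\mathbb R^D$ let $$J_1(r;q,H)=\frac1{\# U}\sum_{r_i\in U}\operatorname{dist}^2(r_i-q,H),\qquad U=\{r_i:\operatorname{dist}(r_i,r)<\sqrt{\sigma\tau}\}$$ (with the value $0$ if $U$ is empty), and let $(q^*,H^*)$ denote any minimiser of $J_1(r;\cdot,\cdot)$ over all pairs $(q,H)$ with $r-q\perp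 H$ and $\|r-q\|<2\sigma$. Then: 1. For every $\delta>0$ there is $N_\delta$ (which may depend on $\mathcal M$, $\sigma$ and $\delta$, but not on $r$) such that for all $r\in\mathcal M_\sigma$ and all $n>N_\delta$, with probability at least $1-\delta$, every such minimiser satisfies $$\angle_{\max}(H^*,T_p\mathcal M)\le\sqrt{C_M/M},\qquad p=P_{\mathcal M}(q^*),$$ where $\angle_{\max}$ is the largest principal angle. 2. For all $r\in\mathcal M_\sigma$, all $n$ and all values of the samples, every such minimiser $q^*$ has a unique nearest point $p=P_{\mathcal M}(q^*)$ in $\mathcal M$, and $\|p-q^*\|\le 3\sigma$. -/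

import Mathlib

open MeasureTheory
open scoped ENNReal Topology

noncomputable section

/-- The ambient Euclidean space `ℝ^D`. -/
abbrev Amb (D : ℕ) : Type := EuclideanSpace ℝ (Fin D)

/-- `S` is a `d`-dimensional (embedded, boundaryless) submanifold of `ℝ^D` of class `C^k`:
around each of its points there is a `C^k` diffeomorphism `Φ` between open subsets of `ℝ^D`
that carries `S` to a `d`-dimensional linear subspace. -/
def IsSubmanifold (k d : ℕ) {D : ℕ} (S : Set (Amb D)) : Prop :=
  ∀ p ∈ S, ∃ (Φ : OpenPartialHomeomorph (Amb D) (Amb D)) (L : Submodule ℝ (Amb D)),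
    p ∈ Φ.source ∧ Module.finrank ℝ L = d ∧
    ContDiffOn ℝ k Φ Φ.source ∧ ContDiffOn ℝ k Φ.symm Φ.target ∧
    ∀ x ∈ Φ.source, (x ∈ S ↔ Φ x ∈ L)

/-- The tangent space `T_p S`, spanned by the velocities at `p` of the curves in `S` through `p`
(for a submanifold these velocities already form a linear subspace). -/
def tangentSubspace {D : ℕ} (S : Set (Amb D)) (p : Amb D) : Submodule ℝ (Amb D) :=
  Submodule.span ℝ {v | ∃ γ : ℝ → Amb D, γ 0 = p ∧ (∀ᶠ t in 𝓝 (0 : ℝ), γ t ∈ S) ∧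
    HasDerivAt γ v 0}

/-- `p` is a point of `A` nearest to `x`; when there is only one, `p = P_A(x)`. -/
def IsNearestPoint {D : ℕ} (A : Set (Amb D)) (x p : Amb D) : Prop :=
  p ∈ A ∧ dist x p = Metric.infDist x A

/-- The reach of `A`: the supremum of the `t ∈ [0, ∞]` such that every point at distance at most
`t` from `A` has a unique nearest point in `A`. -/
def reach {D : ℕ} (A : Set (Amb D)) : ℝ≥0∞ :=
  sSup {t | ∀ x, Metric.infEDist x A ≤ t → ∃! p, IsNearestPoint A x p}

/-- `(u i, w i)`, `i = 0, …, m - 1`, are successive principal pairs of vectors of the subspaces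
`U` and `W`: the pair of index `i` minimises `arccos |⟪u, w⟫|` among the pairs of unit vectors
`u ∈ U`, `w ∈ W` with `u` orthogonal to the earlier `u j` and `w` to the earlier `w j`. -/
structure IsPrincipalPairs {D m : ℕ} (U W : Submodule ℝ (Amb D)) (u w : Fin m → Amb D) :
    Prop where
  left_mem : ∀ i, u i ∈ U
  right_mem : ∀ i, w i ∈ W
  left_norm : ∀ i, ‖u i‖ = 1
  right_norm : ∀ i, ‖w i‖ = 1
  left_orthogonal : ∀ i j, j < i → inner ℝ (u j) (u i) = 0
  right_orthogonal : ∀ i j, j < i → inner ℝ (w j) (w i) = 0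
  minimal : ∀ i, ∀ x ∈ U, ∀ y ∈ W, ‖x‖ = 1 → ‖y‖ = 1 →
    (∀ j, j < i → inner ℝ (u j) x = 0) → (∀ j, j < i → inner ℝ (w j) y = 0) →
    Real.arccos |inner ℝ (u i) (w i)| ≤ Real.arccos |inner ℝ x y|

/-- The maximal principal angle `∠_max(U, W)` of two subspaces of the same dimension: the largest
of the angles of `dim U` principal pairs (`0` for zero-dimensional subspaces). -/
def maxPrincipalAngle {D : ℕ} (U W : Submodule ℝ (Amb D)) : ℝ :=
  sSup {β | ∃ u w : Fin (Module.finrank ℝ U) → Amb D, IsPrincipalPairs U W u w ∧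
    ∃ i, β = Real.arccos |inner ℝ (u i) (w i)|}

open Classical in
/-- The indices of the samples in the region of interest `{x | dist(x, r) < ρ}`. -/
def roi {D n : ℕ} (X : Fin n → Amb D) (r : Amb D) (ρ : ℝ) : Finset (Fin n) :=
  Finset.univ.filter fun i => dist (X i) r < ρ

/-- The functional `J₁(r; q, H)`: the mean of `dist²(r_i - q, H)` over the samples in the region
of interest of radius `ρ` about `r`. -/
def J₁ {D n : ℕ} (X : Fin n → Amb D) (ρ : ℝ) (r q : Amb D) (H : Submodule ℝ (Amb D)) : ℝ :=
  (1 / ((roi X r ρ).card : ℝ)) *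
    ∑ i ∈ roi X r ρ, Metric.infDist (X i - q) (H : Set (Amb D)) ^ 2

/-- The search space: `H ∈ Gr(d, D)`, `r - q ⊥ H` and `‖r - q‖ < 2σ`. -/
def IsAdmissible {D : ℕ} (d : ℕ) (σ : ℝ) (r q : Amb D) (H : Submodule ℝ (Amb D)) : Prop :=
  Module.finrank ℝ H = d ∧ r - q ∈ Hᗮ ∧ ‖r - q‖ < 2 * σ

/-- `(q, H)` minimises `J₁(r; ·, ·)`, with region of interest of radius `√(στ)`, over the search
space. -/
def IsMinimiser {D n : ℕ} (d : ℕ) (σ τ : ℝ) (X : Fin n → Amb D) (r q : Amb D)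
    (H : Submodule ℝ (Amb D)) : Prop :=
  IsAdmissible d σ r q H ∧
  ∀ q' H', IsAdmissible d σ r q' H' →
    J₁ X (Real.sqrt (σ * τ)) r q H ≤ J₁ X (Real.sqrt (σ * τ)) r q' H'

/-- The joint law of `n` independent samples drawn uniformly (normalised Lebesgue measure) from
the open tubular neighbourhood `{x | dist(x, S) < σ}` of `S`. -/
def sampleLaw {D : ℕ} (n : ℕ) (S : Set (Amb D)) (σ : ℝ) : Measure (Fin n → Amb D) :=
  Measure.pi fun _ => ProbabilityTheory.cond volume (Metric.thickening σ S)

end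

/-! Write `ρ = √(στ)`, so that `ρ²/τ = σ` and `σ/ρ = 1/√M`. Let `a` be the foot of `r` on `S` and
`T` the tangent space at `a`. At scale `ρ` the manifold leaves the affine plane `a + T` by only
`O(σ)`, so the samples near `r` fill a slab of thickness `O(σ)` and width `ρ`. A plane fitting this
slab in mean square with error `O(σ)` can be tilted against `T` by at most `O(σ/ρ)`.

The upper bound is deterministic: the pair `(a, T)` is admissible and has functional at most `9σ²`,
hence so does every minimiser (`minimiser_J₁_le`). For the lower bound take `v ⊥ H` and let `u` be
its projection to `T`. For each coordinate direction `±b j` of `T`, a fixed proportion `capRatio d`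
of the samples in the region of interest lies over a small ball of `T` about `±(ρ/2) b j`. For a
suitable direction and sign those samples satisfy `|⟪x - q, u⟫| ≥ ρ‖u‖ / (4(d+1))`, whereas the mean
of `⟪x - q, u⟫²` is at most `90 σ²‖v‖²`; so `‖u‖ ≤ slopeConst d * (σ/ρ) * ‖v‖`
(`norm_tangent_part_le`). The foot `p` of `q` is within `6σ` of `a`, so replacing `T` by the tangent
space at `p` costs another `O(σ/τ)`.

The good event speaks only of sample counts, never of minimisers, so it is plainly measurable. Its
probability comes from Chebyshev's inequality for `2d` bounded functions (`exists_sampling_event`).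
The constant depends on `d` alone because over `T` the tube is, up to factors `(1 ± η)^m` with `m ≤
D`, a product of `T` with a ball of radius `σ` (`volume_tubeCap_ge`); keeping these factors harmless
is what makes the threshold depend on `D`.

The geometry rests on Federer's reach inequality `|⟪b - a, ν⟫| ≤ ‖b - a‖² ‖ν‖ / (2τ)` for `ν` normal
at `a` (`inner_le`, `abs_inner_le`). Since `S` may be only `C¹`, no curvature is available: the
inequality is derived from unique projections, and the Lipschitz variation of tangent spaces is
derived from it. -/

/-! ### Tangent spaces through straightening charts. -/

/-- A `C¹` chart straightening `S` near `p`, with its invertible derivative at `p`. -/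
structure TangentChart (d : ℕ) {D : ℕ} (S : Set (Amb D)) (p : Amb D) where
  Φ : OpenPartialHomeomorph (Amb D) (Amb D)
  L : Submodule ℝ (Amb D)
  A : Amb D ≃L[ℝ] Amb D
  mem_source : p ∈ Φ.source
  finrank_eq : Module.finrank ℝ L = d
  hasFDerivAt : HasFDerivAt Φ (A : Amb D →L[ℝ] Amb D) p
  hasFDerivAt_symm : HasFDerivAt Φ.symm (A.symm : Amb D →L[ℝ] Amb D) (Φ p)
  mem_iff : ∀ x ∈ Φ.source, (x ∈ S ↔ Φ x ∈ L)

theorem IsSubmanifold.nonempty_tangentChart {k d D : ℕ} {S : Set (Amb D)} (hk : 1 ≤ k)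
    (hS : IsSubmanifold k d S) {p : Amb D} (hp : p ∈ S) : Nonempty (TangentChart d S p) := by
  obtain ⟨Φ, L, hpΦ, hL, h1, h2, h3⟩ := hS p hp
  have hk' : ((k : ℕ) : WithTop ℕ∞) ≠ 0 := by
    have : k ≠ 0 := by omega
    exact_mod_cast this
  have d1 : DifferentiableAt ℝ Φ p :=
    (h1.contDiffAt (Φ.open_source.mem_nhds hpΦ)).differentiableAt hk'
  have d2 : DifferentiableAt ℝ Φ.symm (Φ p) :=
    (h2.contDiffAt (Φ.open_target.mem_nhds (Φ.map_source hpΦ))).differentiableAt hk'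
  have e1 : (fderiv ℝ Φ.symm (Φ p)).comp (fderiv ℝ Φ p) = ContinuousLinearMap.id ℝ _ := by
    have := d2.hasFDerivAt.comp p d1.hasFDerivAt
    refine this.unique ((hasFDerivAt_id p).congr_of_eventuallyEq ?_)
    exact Φ.eventually_left_inverse hpΦ
  have e2 : (fderiv ℝ Φ p).comp (fderiv ℝ Φ.symm (Φ p)) = ContinuousLinearMap.id ℝ _ := by
    have d1' : HasFDerivAt Φ (fderiv ℝ Φ p) (Φ.symm (Φ p)) := by
      rw [Φ.left_inv hpΦ]; exact d1.hasFDerivAt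
    have := d1'.comp (Φ p) d2.hasFDerivAt
    refine this.unique ((hasFDerivAt_id (Φ p)).congr_of_eventuallyEq ?_)
    exact Φ.eventually_right_inverse (Φ.map_source hpΦ)
  exact ⟨⟨Φ, L, ContinuousLinearEquiv.equivOfInverse (fderiv ℝ Φ p) (fderiv ℝ Φ.symm (Φ p))
    (fun x => by simpa using congrArg (fun f => f x) e1)
    (fun x => by simpa using congrArg (fun f => f x) e2), hpΦ, hL, d1.hasFDerivAt, d2.hasFDerivAt, h3⟩⟩

namespace TangentChart

variable {d D : ℕ} {S : Set (Amb D)} {p : Amb D}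

/-- The difference quotients of `Φ ∘ γ` lie in the closed subspace `L`, hence so does their limit.
-/
theorem velocity_mem (c : TangentChart d S p) {γ : ℝ → Amb D} {v : Amb D} (h0 : γ 0 = p)
    (hγ : ∀ᶠ t in 𝓝 (0 : ℝ), γ t ∈ S) (hv : HasDerivAt γ v 0) : c.A v ∈ c.L := by
  have hΦ : HasDerivAt (fun t => c.Φ (γ t)) (c.A v) 0 := by
    have h : HasFDerivAt c.Φ (c.A : Amb D →L[ℝ] Amb D) (γ 0) := by
      rw [h0]; exact c.hasFDerivAt
    exact h.comp_hasDerivAt 0 hv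
  have hpS : p ∈ S := h0 ▸ hγ.self_of_nhds
  have hev : ∀ᶠ t in 𝓝 (0 : ℝ), γ t ∈ c.Φ.source := by
    refine hv.continuousAt.eventually (c.Φ.open_source.mem_nhds ?_)
    rw [h0]; exact c.mem_source
  have hL : ∀ᶠ t in 𝓝 (0 : ℝ), c.Φ (γ t) ∈ c.L := by
    filter_upwards [hγ, hev] with t h1 h2 using (c.mem_iff _ h2).1 h1
  have hcl : IsClosed (c.L : Set (Amb D)) := c.L.closed_of_finiteDimensional
  refine hcl.mem_of_tendsto hΦ.tendsto_slope ?_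
  filter_upwards [nhdsWithin_le_nhds hL] with t ht
  rw [slope_def_module]
  exact c.L.smul_mem _ (c.L.sub_mem ht hL.self_of_nhds)

/-- The curve is the pullback by the chart of a straight line in `L`. -/
theorem exists_velocity (c : TangentChart d S p) (hp : p ∈ S) {v : Amb D} (hv : c.A v ∈ c.L) :
    ∃ γ : ℝ → Amb D, γ 0 = p ∧ (∀ᶠ t in 𝓝 (0 : ℝ), γ t ∈ S) ∧ HasDerivAt γ v 0 := by
  have hlin : HasDerivAt (fun t : ℝ => c.Φ p + t • c.A v) (c.A v) 0 := by
    simpa using ((hasDerivAt_id (0 : ℝ)).smul_const (c.A v)).const_add (c.Φ p)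
  refine ⟨fun t => c.Φ.symm (c.Φ p + t • c.A v), ?_, ?_, ?_⟩
  · simp [c.Φ.left_inv c.mem_source]
  · have hev : ∀ᶠ t in 𝓝 (0 : ℝ), c.Φ p + t • c.A v ∈ c.Φ.target := by
      refine hlin.continuousAt.eventually (c.Φ.open_target.mem_nhds ?_)
      simpa using c.Φ.map_source c.mem_source
    filter_upwards [hev] with t ht
    rw [c.mem_iff _ (c.Φ.map_target ht), c.Φ.right_inv ht]
    exact c.L.add_mem ((c.mem_iff _ c.mem_source).1 hp) (c.L.smul_mem _ hv)
  · have h := c.hasFDerivAt_symm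
    have h' : HasFDerivAt c.Φ.symm (c.A.symm : Amb D →L[ℝ] Amb D) (c.Φ p + (0 : ℝ) • c.A v) := by
      simpa using h
    simpa [Function.comp_def] using h'.comp_hasDerivAt (0 : ℝ) hlin

theorem mem_tangentSubspace (c : TangentChart d S p) (hp : p ∈ S) {v : Amb D} :
    v ∈ tangentSubspace S p ↔ c.A v ∈ c.L := by
  constructor
  · intro h
    have : tangentSubspace S p ≤ c.L.comap (c.A : Amb D →ₗ[ℝ] Amb D) := by
      refine Submodule.span_le.2 ?_
      rintro w ⟨γ, h0, h1, h2⟩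
      exact c.velocity_mem h0 h1 h2
    exact this h
  · intro h
    exact Submodule.subset_span (c.exists_velocity hp h)

theorem finrank_tangentSubspace (c : TangentChart d S p) (hp : p ∈ S) :
    Module.finrank ℝ (tangentSubspace S p) = d := by
  have : tangentSubspace S p = c.L.map (c.A.symm.toLinearEquiv : Amb D →ₗ[ℝ] Amb D) := by
    ext v
    rw [c.mem_tangentSubspace hp, Submodule.mem_map]
    constructor
    · intro h; exact ⟨_, h, by simp⟩
    · rintro ⟨w, hw, rfl⟩; simpa using hw
  rw [this, LinearEquiv.finrank_map_eq, c.finrank_eq]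

/-- Secants of `S` at `p` are tangent to first order. -/
theorem inner_isLittleO (c : TangentChart d S p) (hp : p ∈ S) {ν : Amb D}
    (hν : ν ∈ (tangentSubspace S p)ᗮ) :
    (fun b => inner ℝ (b - p) ν) =o[𝓝[S] p] fun b => b - p := by
  have hO : (fun b => c.Φ b - c.Φ p) =O[𝓝 p] fun b => b - p := c.hasFDerivAt.isBigO_sub
  have hs : (fun b => c.Φ.symm (c.Φ b) - c.Φ.symm (c.Φ p) - c.A.symm (c.Φ b - c.Φ p))
      =o[𝓝 p] fun b => c.Φ b - c.Φ p :=
    c.hasFDerivAt_symm.isLittleO.comp_tendsto c.hasFDerivAt.continuousAt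
  have h1 := ((hs.trans_isBigO hO).mono (nhdsWithin_le_nhds (s := S)))
  have h2 : (fun b => inner ℝ
      (c.Φ.symm (c.Φ b) - c.Φ.symm (c.Φ p) - c.A.symm (c.Φ b - c.Φ p)) ν) =o[𝓝[S] p]
      fun b => b - p := by
    refine Asymptotics.IsBigO.trans_isLittleO ?_ h1
    refine Asymptotics.IsBigO.of_bound ‖ν‖ (Filter.Eventually.of_forall fun b => ?_)
    rw [mul_comm]
    exact norm_inner_le_norm _ _
  refine h2.congr' ?_ Filter.EventuallyEq.rfl
  have hsrc : ∀ᶠ b in 𝓝[S] p, b ∈ c.Φ.source :=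
    nhdsWithin_le_nhds (c.Φ.open_source.mem_nhds c.mem_source)
  filter_upwards [hsrc, self_mem_nhdsWithin] with b hb hbS
  rw [c.Φ.left_inv hb, c.Φ.left_inv c.mem_source, inner_sub_left, sub_eq_self]
  -- The linear part `A⁻¹(Φ b - Φ p)` of the secant is exactly tangent, so only the remainder pairs
  -- with `ν`.
  refine (Submodule.mem_orthogonal _ _).1 hν _ ?_
  rw [c.mem_tangentSubspace hp]
  simpa using c.L.sub_mem ((c.mem_iff _ hb).1 hbS) ((c.mem_iff _ c.mem_source).1 hp)

end TangentChart

/-! ### Unique projections and prolongation of normal rays. -/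

/-- `S` is a nonempty compact set all of whose points at distance `< τ` project uniquely to it. -/
structure HasUniqueProjection {D : ℕ} (S : Set (Amb D)) (τ : ℝ) : Prop where
  compact : IsCompact S
  nonempty : S.Nonempty
  pos : 0 < τ
  existsUnique : ∀ x, Metric.infDist x S < τ → ∃! p, IsNearestPoint S x p

variable {D : ℕ} {S : Set (Amb D)} {τ : ℝ}

/-- The supremum in `reach` need not be attained, so uniqueness is claimed only at distances
strictly below `τ`. Nonemptiness holds because the empty set has infinite reach. -/
theorem hasUniqueProjection_of_reach (hS : IsCompact S) (hτ : 0 < τ)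
    (h : reach S = ENNReal.ofReal τ) : HasUniqueProjection S τ := by
  have hne : S.Nonempty := by
    by_contra hne
    rw [Set.not_nonempty_iff_eq_empty] at hne
    subst hne
    have : reach (∅ : Set (Amb D)) = ⊤ := by
      refine ENNReal.eq_top_of_forall_nnreal_le fun r => le_sSup ?_
      intro x hx
      simp at hx
    rw [this] at h
    exact ENNReal.ofReal_ne_top h.symm
  refine ⟨hS, hne, hτ, fun x hx => ?_⟩
  have hlt : ENNReal.ofReal (Metric.infDist x S) < reach S := by
    rw [h]; exact (ENNReal.ofReal_lt_ofReal_iff hτ).2 hx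
  obtain ⟨t, ht, hxt⟩ := lt_sSup_iff.1 hlt
  refine ht x ?_
  rw [Metric.infDist, ENNReal.ofReal_toReal (Metric.infEDist_ne_top hne)] at hxt
  exact hxt.le

theorem IsCompact.exists_isNearestPoint (hS : IsCompact S) (hne : S.Nonempty) (x : Amb D) :
    ∃ p, IsNearestPoint S x p := by
  obtain ⟨p, hp, h⟩ := hS.exists_infDist_eq_dist hne x
  exact ⟨p, hp, h.symm⟩

theorem IsNearestPoint.dist_le {x p b : Amb D} (h : IsNearestPoint S x p) (hb : b ∈ S) :
    dist x p ≤ dist x b := h.2 ▸ Metric.infDist_le_dist_of_mem hb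

/-- Nearest points depend continuously on the point where they are unique. -/
theorem IsCompact.eventually_nearest_mem (hS : IsCompact S) {y p : Amb D}
    (hp : IsNearestPoint S y p) (huniq : ∀ q, IsNearestPoint S y q → q = p) {U : Set (Amb D)}
    (hU : U ∈ 𝓝 p) : ∀ᶠ y' in 𝓝 y, ∀ p', IsNearestPoint S y' p' → p' ∈ U := by
  have hK : IsCompact (S \ interior U) := hS.diff isOpen_interior
  rcases (S \ interior U).eq_empty_or_nonempty with he | hne
  · refine Filter.Eventually.of_forall fun y' p' hp' => ?_
    by_contra hc
    have : p' ∈ S \ interior U := ⟨hp'.1, fun h => hc (interior_subset h)⟩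
    simp [he] at this
  obtain ⟨z, hz, hzd⟩ := hK.exists_infDist_eq_dist hne y
  have hgap : dist y p < dist y z := by
    refine lt_of_le_of_ne (hp.dist_le hz.1) fun h => hz.2 ?_
    rw [huniq z ⟨hz.1, by rw [← h]; exact hp.2⟩]
    exact mem_interior_iff_mem_nhds.2 hU
  have hb : Metric.ball y ((dist y z - dist y p) / 2) ∈ 𝓝 y := Metric.ball_mem_nhds _ (by linarith)
  filter_upwards [hb] with y' hy' p' hp'
  by_contra hc
  have hmem : p' ∈ S \ interior U := ⟨hp'.1, fun h => hc (interior_subset h)⟩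
  have h1 : dist y z ≤ dist y p' := hzd ▸ Metric.infDist_le_dist_of_mem hmem
  have h2 := hp'.dist_le hp.1
  have h3 := dist_triangle y y' p'
  have h4 := dist_triangle y' y p
  rw [Metric.mem_ball] at hy'
  rw [dist_comm y y'] at h3
  linarith

/-- Step from `y` directly away from its foot. By continuity of the projection, the foot `p'` of the
new point is seen from `y` in almost the same direction, so the distance to `S` grows at rate above
`1 - ε`. Differentiability of the distance function is not needed. -/
theorem HasUniqueProjection.exists_climb (hS : HasUniqueProjection S τ) {y : Amb D}
    (h0 : 0 < Metric.infDist y S) (hτ : Metric.infDist y S < τ) {ε e : ℝ} (hε : 0 < ε)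
    (he : 0 < e) : ∃ y', y' ≠ y ∧ dist y' y < e ∧
      Metric.infDist y S + (1 - ε) * dist y' y < Metric.infDist y' S := by
  obtain ⟨p, hp, huniq⟩ := hS.existsUnique y hτ
  have hyp : 0 < ‖y - p‖ := by rw [← dist_eq_norm, hp.2]; exact h0
  set n : Amb D := ‖y - p‖⁻¹ • (y - p) with hn
  have hn1 : ‖n‖ = 1 := by
    rw [hn, norm_smul, norm_inv, norm_norm, inv_mul_cancel₀ hyp.ne']
  have hcont : ContinuousAt (fun p' : Amb D => inner ℝ n (‖y - p'‖⁻¹ • (y - p'))) p := by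
    have h1 : ContinuousAt (fun p' : Amb D => ‖y - p'‖) p := by fun_prop
    have h2 : ContinuousAt (fun p' : Amb D => ‖y - p'‖⁻¹ • (y - p')) p :=
      (h1.inv₀ hyp.ne').smul (by fun_prop)
    exact ContinuousAt.inner continuousAt_const h2
  have hval : inner ℝ n (‖y - p‖⁻¹ • (y - p)) = (1 : ℝ) := by
    rw [← hn, real_inner_self_eq_norm_sq, hn1]; norm_num
  have hU : {p' : Amb D | 1 - ε < inner ℝ n (‖y - p'‖⁻¹ • (y - p'))} ∈ 𝓝 p := by
    refine hcont.eventually (lt_mem_nhds ?_)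
    change 1 - ε < inner ℝ n (‖y - p‖⁻¹ • (y - p))
    rw [hval]; linarith
  have hev := hS.compact.eventually_nearest_mem hp huniq hU
  have hline : Filter.Tendsto (fun h : ℝ => y + h • n) (𝓝[>] 0) (𝓝 y) := by
    have : Continuous fun h : ℝ => y + h • n := by fun_prop
    have := this.tendsto 0
    simp only [zero_smul, add_zero] at this
    exact this.mono_left nhdsWithin_le_nhds
  obtain ⟨h, hh, hhe, hpos⟩ := ((hline.eventually hev).and
    ((Filter.eventually_of_mem (Ioo_mem_nhdsGT he) fun _ h => h) )).exists
  have hdist : dist (y + h • n) y = h := by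
    rw [dist_eq_norm, add_sub_cancel_left, norm_smul, hn1, mul_one, Real.norm_eq_abs,
      abs_of_pos hhe]
  refine ⟨y + h • n, ?_, by rw [hdist]; exact hpos, ?_⟩
  · intro hc
    rw [hc, dist_self] at hdist
    exact hhe.ne hdist
  obtain ⟨p', hp'⟩ := hS.compact.exists_isNearestPoint hS.nonempty (y + h • n)
  have hin := hh p' hp'
  rw [hdist, ← hp'.2, dist_eq_norm]
  have hyp' : Metric.infDist y S ≤ ‖y - p'‖ := by
    rw [← dist_eq_norm]; exact Metric.infDist_le_dist_of_mem hp'.1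
  have hpos' : 0 < ‖y - p'‖ := h0.trans_le hyp'
  have hle : inner ℝ (y + h • n - p') (‖y - p'‖⁻¹ • (y - p')) ≤ ‖y + h • n - p'‖ := by
    refine (real_inner_le_norm _ _).trans ?_
    rw [norm_smul, norm_inv, norm_norm, inv_mul_cancel₀ hpos'.ne', mul_one]
  have heq : inner ℝ (y + h • n - p') (‖y - p'‖⁻¹ • (y - p'))
      = ‖y - p'‖ + h * inner ℝ n (‖y - p'‖⁻¹ • (y - p')) := by
    have : y + h • n - p' = (y - p') + h • n := by abel
    rw [this, inner_add_left, real_inner_smul_left, real_inner_smul_right,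
      real_inner_self_eq_norm_sq]
    field_simp
  have : (1 - ε) * h < h * inner ℝ n (‖y - p'‖⁻¹ • (y - p')) := by
    rw [mul_comm]
    exact mul_lt_mul_of_pos_left hin hhe
  linarith

/-- Nearest points persist along the outward ray up to distance `τ`. -/
theorem HasUniqueProjection.isNearestPoint_ray (hS : HasUniqueProjection S τ) {x a : Amb D}
    (ha : IsNearestPoint S x a) {t : ℝ} (ht : 1 ≤ t) (htτ : t * dist x a < τ) :
    IsNearestPoint S (a + t • (x - a)) a := by
  rcases (dist_nonneg (x := x) (y := a)).eq_or_lt with h0 | h0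
  · have : x = a := dist_eq_zero.1 h0.symm
    subst this
    simpa using ha
  set s₀ := dist x a with hs₀
  set h := (t - 1) * s₀ with hh
  have hh0 : 0 ≤ h := mul_nonneg (by linarith) h0.le
  have hlip : ∀ y, Metric.infDist y S ≤ s₀ + dist y x := by
    intro y
    rw [hs₀, ha.2]
    exact Metric.infDist_le_infDist_add_dist
  -- Maximise `infDist y S - (1 - ε) dist y x` over the ball of radius `h` about `x`. At an interior
  -- maximum `exists_climb` would still find a better point, so the maximum lies on the sphere.
  have hmax : ∀ ε : ℝ, 0 < ε → ε < 1 → ∃ y ∈ Metric.sphere x h,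
      s₀ + (1 - ε) * h ≤ Metric.infDist y S := by
    intro ε hε hε1
    have hc : ContinuousOn (fun y => Metric.infDist y S - (1 - ε) * dist y x)
        (Metric.closedBall x h) := by
      apply Continuous.continuousOn
      have := Metric.continuous_infDist_pt S
      fun_prop
    obtain ⟨y, hy, hymax⟩ := (isCompact_closedBall x h).exists_isMaxOn
      ⟨x, Metric.mem_closedBall_self hh0⟩ hc
    have hyx := hymax (Metric.mem_closedBall_self hh0)
    simp only [Set.mem_ofPred_eq, dist_self, mul_zero, sub_zero, ← ha.2] at hyx
    rw [← hs₀] at hyx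
    have hyh : dist y x = h := by
      refine le_antisymm (Metric.mem_closedBall.1 hy) (le_of_not_gt fun hlt => ?_)
      have hpos : 0 < Metric.infDist y S := by
        have : 0 ≤ (1 - ε) * dist y x := mul_nonneg (by linarith) dist_nonneg
        linarith
      have hltτ : Metric.infDist y S < τ := by
        have := hlip y
        have : t * s₀ = s₀ + h := by rw [hh]; ring
        linarith
      obtain ⟨y', hne, hd, hcl⟩ := hS.exists_climb hpos hltτ hε (sub_pos.2 hlt)
      have hmem : y' ∈ Metric.closedBall x h := by
        rw [Metric.mem_closedBall]
        have := dist_triangle y' y x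
        linarith
      have := hymax hmem
      simp only [Set.mem_ofPred_eq] at this
      have htri := dist_triangle y' y x
      have : (1 - ε) * dist y' x ≤ (1 - ε) * (dist y' y + dist y x) :=
        mul_le_mul_of_nonneg_left htri (by linarith)
      linarith
    refine ⟨y, hyh, ?_⟩
    rw [hyh] at hyx
    linarith
  obtain ⟨y₁, hy₁, -⟩ := hmax (1 / 2) (by norm_num) (by norm_num)
  obtain ⟨y, hy, hymax⟩ := (isCompact_sphere x h).exists_isMaxOn ⟨y₁, hy₁⟩
    (Metric.continuous_infDist_pt S).continuousOn
  have hge : s₀ + h ≤ Metric.infDist y S := by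
    refine le_of_forall_pos_sub_le fun η hη => ?_
    obtain ⟨z, hz, hzε⟩ := hmax (min (1 / 2) (η / (h + 1))) (by positivity)
      (lt_of_le_of_lt (min_le_left _ _) (by norm_num))
    refine le_trans ?_ (hzε.trans (hymax hz))
    have h1 : min (1 / 2) (η / (h + 1)) * h ≤ η := by
      calc _ ≤ η / (h + 1) * h := mul_le_mul_of_nonneg_right (min_le_right _ _) hh0
        _ ≤ η / (h + 1) * (h + 1) := by gcongr; linarith
        _ = η := by field_simp
    linarith
  have hya : Metric.infDist y S ≤ dist y a := Metric.infDist_le_dist_of_mem ha.1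
  have hyx : dist y x = h := hy
  have htri := dist_triangle y x a
  -- Equality in the triangle inequality through `x` forces `y` onto the ray from `a` through `x`.
  have hray : SameRay ℝ (y - x) (x - a) := by
    rw [sameRay_iff_norm_add, sub_add_sub_cancel, ← dist_eq_norm, ← dist_eq_norm, ← dist_eq_norm]
    linarith
  have hsm := sameRay_iff_norm_smul_eq.1 hray
  rw [← dist_eq_norm, ← dist_eq_norm, hyx, ← hs₀, hh, mul_comm, mul_smul] at hsm
  have hyeq : y = a + t • (x - a) := by
    have := smul_right_injective (Amb D) h0.ne' hsm
    rw [sub_smul, one_smul] at this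
    rw [eq_comm, sub_eq_iff_eq_add] at this
    rw [this]; abel
  rw [← hyeq]
  exact ⟨ha.1, by linarith⟩

/-! ### Federer's reach inequality and variation of tangent spaces. -/

section

variable {D : ℕ} {S : Set (Amb D)} {τ : ℝ}

theorem IsNearestPoint.sub_mem_orthogonal {x a : Amb D} (h : IsNearestPoint S x a) :
    x - a ∈ (tangentSubspace S a)ᗮ := by
  rw [Submodule.mem_orthogonal]
  intro v hv
  refine Submodule.span_induction (p := fun v _ => inner ℝ v (x - a) = 0) ?_ ?_ ?_ ?_ hv
  · rintro v ⟨γ, h0, h1, h2⟩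
    have hd : HasDerivAt (fun t => ‖x - γ t‖ ^ 2) (2 * inner ℝ (x - γ 0) (-v)) 0 := by
      simpa using (h2.const_sub x).norm_sq
    have hmin : IsLocalMin (fun t => ‖x - γ t‖ ^ 2) 0 := by
      filter_upwards [h1] with t ht
      have := h.dist_le ht
      rw [dist_eq_norm, dist_eq_norm] at this
      rw [h0]
      gcongr
    have := hmin.hasDerivAt_eq_zero hd
    rw [h0, inner_neg_right, real_inner_comm] at this
    linarith
  · simp
  · intro u w _ _ hu hw
    rw [inner_add_left, hu, hw, add_zero]
  · intro c u _ hu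
    rw [real_inner_smul_left, hu, mul_zero]

/-- The part of the regularity of `S` used below: uniqueness of projections within `τ`,
and first order tangency of secants at every point. -/
structure IsReachManifold (d : ℕ) (S : Set (Amb D)) (τ : ℝ) : Prop
    extends HasUniqueProjection S τ where
  chart : ∀ p ∈ S, Nonempty (TangentChart d S p)

namespace IsReachManifold

variable {d : ℕ}

/-- Points of `S` stay outside the ball of radius `τ` touching `S` at `a`. -/
theorem inner_le (hS : IsReachManifold d S τ) {a b ν : Amb D} (ha : a ∈ S) (hb : b ∈ S)
    (hν : ν ∈ (tangentSubspace S a)ᗮ) (hν1 : ‖ν‖ = 1) :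
    2 * τ * inner ℝ (b - a) ν ≤ ‖b - a‖ ^ 2 := by
  obtain ⟨c⟩ := hS.chart a ha
  choose P hP using fun s : ℝ => hS.compact.exists_isNearestPoint hS.nonempty (a + s • ν)
  have hdist : ∀ s : ℝ, 0 < s → dist (a + s • ν) (P s) ≤ s := by
    intro s hs
    refine ((hP s).dist_le ha).trans ?_
    rw [dist_eq_norm, add_sub_cancel_left, norm_smul, hν1, mul_one, Real.norm_eq_abs,
      abs_of_pos hs]
  have hPa : ∀ s : ℝ, 0 < s → ‖P s - a‖ ^ 2 ≤ 2 * s * inner ℝ (P s - a) ν := by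
    intro s hs
    have h1 := hdist s hs
    rw [dist_eq_norm] at h1
    have h2 : a + s • ν - P s = s • ν - (P s - a) := by abel
    have h3 : ‖a + s • ν - P s‖ ^ 2 ≤ s ^ 2 := by gcongr
    rw [h2, norm_sub_sq_real, norm_smul, hν1, real_inner_smul_left, real_inner_comm, mul_one,
      Real.norm_eq_abs, sq_abs] at h3
    linarith
  have hP2 : ∀ s : ℝ, 0 < s → ‖P s - a‖ ≤ 2 * s := by
    intro s hs
    have h1 := hPa s hs
    have h2 : inner ℝ (P s - a) ν ≤ ‖P s - a‖ := by
      simpa [hν1] using real_inner_le_norm (P s - a) ν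
    have h4 := norm_nonneg (P s - a)
    have h5 : 2 * s * inner ℝ (P s - a) ν ≤ 2 * s * ‖P s - a‖ := by gcongr
    by_contra hc
    nlinarith
  have hPt : Filter.Tendsto P (𝓝[>] 0) (𝓝[S] a) := by
    refine tendsto_nhdsWithin_iff.2 ⟨?_, Filter.Eventually.of_forall fun s => (hP s).1⟩
    rw [tendsto_iff_norm_sub_tendsto_zero]
    have h2 : Filter.Tendsto (fun s : ℝ => 2 * s) (𝓝[>] 0) (𝓝 0) := by
      have : Continuous fun s : ℝ => 2 * s := by fun_prop
      have := this.tendsto 0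
      rw [mul_zero] at this
      exact this.mono_left nhdsWithin_le_nhds
    refine squeeze_zero' (Filter.Eventually.of_forall fun _ => norm_nonneg _) ?_ h2
    filter_upwards [self_mem_nhdsWithin] with s hs using hP2 s hs
  -- It is not known that `a` is the foot of `a + s • ν`. But `‖P s - a‖² ≤ 2s⟪P s - a, ν⟫`, and the
  -- inner product is `o(‖P s - a‖)` by first order tangency; hence `P s - a = o(s)` and the true
  -- normal direction at `P s` tends to `ν`.
  have hlit : (fun s => P s - a) =o[𝓝[>] 0] fun s : ℝ => s := by
    have h1 := (c.inner_isLittleO ha hν).comp_tendsto hPt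
    rw [Asymptotics.isLittleO_iff] at h1 ⊢
    intro η hη
    filter_upwards [h1 (half_pos hη), self_mem_nhdsWithin] with s hs hs0
    simp only [Function.comp_apply] at hs
    have h2 := hPa s hs0
    have h3 := (le_abs_self _).trans hs
    have h4 := norm_nonneg (P s - a)
    have hs0' : (0 : ℝ) < s := hs0
    rw [Real.norm_eq_abs, abs_of_pos hs0']
    have h5 : 2 * s * inner ℝ (P s - a) ν ≤ 2 * s * (η / 2 * ‖P s - a‖) := by gcongr
    by_contra hcon
    have : 0 < ‖P s - a‖ := by
      by_contra h; have : ‖P s - a‖ = 0 := le_antisymm (not_lt.1 h) h4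
      exact hcon (by rw [this]; positivity)
    nlinarith
  have hdir : Filter.Tendsto (fun s => s⁻¹ • (a + s • ν - P s)) (𝓝[>] 0) (𝓝 ν) := by
    have h1 : Filter.Tendsto (fun s : ℝ => s⁻¹ • (P s - a)) (𝓝[>] 0) (𝓝 0) := by
      exact hlit.tendsto_inv_smul_nhds_zero
    have h2 := h1.const_sub ν
    rw [sub_zero] at h2
    refine h2.congr' ?_
    filter_upwards [self_mem_nhdsWithin] with s hs
    have hs' : s ≠ 0 := ne_of_gt hs
    rw [show a + s • ν - P s = s • ν - (P s - a) by abel, smul_sub s⁻¹ (s • ν),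
      inv_smul_smul₀ hs']
  have hPt' : Filter.Tendsto P (𝓝[>] 0) (𝓝 a) := hPt.mono_right nhdsWithin_le_nhds
  -- Prolong the ray from `P s` through `a + s • ν` by the factor `t / s`. The point reached still
  -- has `P s` as a nearest point, so `b` is no closer; then let `s → 0`.
  have key : ∀ t : ℝ, 0 < t → t < τ → 0 ≤ ‖a - b‖ ^ 2 + 2 * t * inner ℝ ν (a - b) := by
    intro t ht htτ
    have hlim : Filter.Tendsto (fun s => ‖P s - b‖ ^ 2 + 2 * t *
        inner ℝ (s⁻¹ • (a + s • ν - P s)) (P s - b)) (𝓝[>] 0)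
        (𝓝 (‖a - b‖ ^ 2 + 2 * t * inner ℝ ν (a - b))) :=
      ((hPt'.sub_const b).norm.pow 2).add ((hdir.inner (hPt'.sub_const b)).const_mul _)
    refine ge_of_tendsto hlim ?_
    filter_upwards [Ioo_mem_nhdsGT ht] with s hs
    have hs0 : 0 < s := hs.1
    have hray := hS.isNearestPoint_ray (hP s) (t := t / s) ((one_le_div hs0).2 hs.2.le) (by
      calc t / s * dist (a + s • ν) (P s) ≤ t / s * s := by
            have := hdist s hs0; gcongr
        _ = t := by field_simp
        _ < τ := htτ)
    have hle := hray.dist_le hb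
    rw [dist_eq_norm, dist_eq_norm] at hle
    set w := (t / s) • (a + s • ν - P s) with hw
    have h2 : ‖w‖ ^ 2 ≤ ‖w + (P s - b)‖ ^ 2 := by
      rw [show P s + w - P s = w by abel, show P s + w - b = w + (P s - b) by abel] at hle
      gcongr
    rw [norm_add_sq_real] at h2
    have h3 : inner ℝ w (P s - b) = t * inner ℝ (s⁻¹ • (a + s • ν - P s)) (P s - b) := by
      rw [hw, div_eq_mul_inv, mul_smul, real_inner_smul_left]
    rw [h3] at h2
    linarith
  have hfin : 0 ≤ ‖a - b‖ ^ 2 + 2 * τ * inner ℝ ν (a - b) := by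
    have hc : Continuous fun t : ℝ => ‖a - b‖ ^ 2 + 2 * t * inner ℝ ν (a - b) := by fun_prop
    have hc' := (hc.tendsto τ).mono_left (nhdsWithin_le_nhds (s := Set.Iio τ))
    refine ge_of_tendsto hc' ?_
    filter_upwards [Ioo_mem_nhdsLT hS.pos] with t ht using key t ht.1 ht.2
  have h1 : inner ℝ ν (a - b) = - inner ℝ (b - a) ν := by
    rw [real_inner_comm, ← neg_sub b a, inner_neg_left]
  rw [h1, norm_sub_rev] at hfin
  linarith

theorem abs_inner_le (hS : IsReachManifold d S τ) {a b ν : Amb D} (ha : a ∈ S) (hb : b ∈ S)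
    (hν : ν ∈ (tangentSubspace S a)ᗮ) :
    |inner ℝ (b - a) ν| ≤ ‖b - a‖ ^ 2 / (2 * τ) * ‖ν‖ := by
  have hτ := hS.pos
  rcases eq_or_ne ν 0 with rfl | h0
  · simp
  have hn : 0 < ‖ν‖ := norm_pos_iff.2 h0
  have hunit : ‖‖ν‖⁻¹ • ν‖ = 1 := by
    rw [norm_smul, norm_inv, norm_norm, inv_mul_cancel₀ hn.ne']
  have h1 := hS.inner_le ha hb (Submodule.smul_mem _ ‖ν‖⁻¹ hν) hunit
  have h2 := hS.inner_le ha hb (Submodule.neg_mem _ (Submodule.smul_mem _ ‖ν‖⁻¹ hν))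
    (by rw [norm_neg, hunit])
  rw [inner_neg_right] at h2
  have h3 : inner ℝ (b - a) ν = ‖ν‖ * inner ℝ (b - a) (‖ν‖⁻¹ • ν) := by
    rw [real_inner_smul_right]; field_simp
  rw [h3, abs_mul, abs_of_pos hn, mul_comm]
  gcongr
  rw [abs_le, le_div_iff₀ (by positivity), ← neg_div, div_le_iff₀ (by positivity)]
  constructor <;> linarith

/-- Tangent lines stay close to `S`. -/
theorem infDist_add_smul_le (hS : IsReachManifold d S τ) {a u : Amb D} (ha : a ∈ S)
    (hu : u ∈ tangentSubspace S a) (hu1 : ‖u‖ = 1) {s : ℝ} (hs : 0 < s) :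
    Metric.infDist (a + s • u) S ≤ 3 * s ^ 2 / τ := by
  have hτ := hS.pos
  obtain ⟨c⟩ := hS.chart a ha
  obtain ⟨γ, h0, h1, h2⟩ := c.exists_velocity ha ((c.mem_tangentSubspace ha).1 hu)
  have main : ∀ η : ℝ, 0 < η → Metric.infDist (a + s • u) S ≤ η * s + 3 / τ * s ^ 2 := by
    intro η hη
    have hsmall : ∀ᶠ t in 𝓝[>] (0 : ℝ), Metric.infDist (a + t • u) S ≤ η * t := by
      have h3 := (hasDerivAt_iff_isLittleO.1 h2)
      have h4 := Asymptotics.isLittleO_iff.1 h3 hη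
      filter_upwards [nhdsWithin_le_nhds h4, nhdsWithin_le_nhds h1, self_mem_nhdsWithin]
        with t ht htS ht0
      refine (Metric.infDist_le_dist_of_mem htS).trans ?_
      rw [h0, sub_zero, Real.norm_eq_abs, abs_of_pos ht0] at ht
      rw [dist_comm, dist_eq_norm]
      convert! ht using 2
      abel
    obtain ⟨s', hs', hs'0, hs's⟩ := (hsmall.and (Ioo_mem_nhdsGT hs)).exists
    choose P hP using fun x : ℝ => hS.compact.exists_isNearestPoint hS.nonempty (a + x • u)
    -- Comparison argument for `f x = infDist (a + x • u) S` against `B x = ηx + 3x²/τ`. The slope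
    -- of `f` is bounded by that of the distance to the frozen foot `P x`. At a contact point `f =
    -- B`, the reach inequality at `P x` bounds this by `f/x + 2x/τ = η + 5x/τ`, below `B' = η +
    -- 6x/τ`. The value `1` serves points lying on `S`.
    have hcomp := image_le_of_liminf_slope_right_lt_deriv_boundary'
      (f := fun x : ℝ => Metric.infDist (a + x • u) S)
      (f' := fun x => if ‖a + x • u - P x‖ = 0 then 1 else
        inner ℝ (a + x • u - P x) u / ‖a + x • u - P x‖)
      (a := s') (b := s) (B := fun x => η * x + 3 / τ * x ^ 2)
      (B' := fun x => η + 3 / τ * (2 * x)) ?_ ?_ ?_ ?_ ?_ ?_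
    · exact hcomp (Set.right_mem_Icc.2 hs's.le)
    · have h := Metric.continuous_infDist_pt S
      exact Continuous.continuousOn (by fun_prop)
    · intro x hx r hr
      refine Filter.Eventually.frequently ?_
      have hfx : Metric.infDist (a + x • u) S = ‖a + x • u - P x‖ := by
        rw [← (hP x).2, dist_eq_norm]
      have hslope : ∀ z ∈ Set.Ioi x, slope (fun x : ℝ => Metric.infDist (a + x • u) S) x z ≤
          slope (fun z : ℝ => ‖a + z • u - P x‖) x z := by
        intro z hz
        rw [slope_def_field, slope_def_field, hfx]
        have hz' : (0 : ℝ) < z - x := sub_pos.2 hz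
        gcongr
        rw [← dist_eq_norm]
        exact Metric.infDist_le_dist_of_mem (hP x).1
      split_ifs at hr with h
      · filter_upwards [self_mem_nhdsWithin] with z hz
        refine (hslope z hz).trans_lt (lt_of_eq_of_lt ?_ hr)
        have hz' : (0 : ℝ) < z - x := sub_pos.2 hz
        rw [slope_def_field, h, ← sub_eq_zero.1 (norm_eq_zero.1 h), add_sub_add_left_eq_sub,
          ← sub_smul, norm_smul, hu1, mul_one, Real.norm_eq_abs, abs_of_pos hz', sub_zero,
          div_self hz'.ne']
      · have hlin : HasDerivAt (fun z : ℝ => a + z • u - P x) u x := by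
          simpa using (((hasDerivAt_id x).smul_const u).const_add a).sub_const (P x)
        have hsq := hlin.norm_sq.sqrt (pow_ne_zero 2 h)
        simp only [Real.sqrt_sq (norm_nonneg _)] at hsq
        rw [mul_div_mul_left _ _ two_ne_zero] at hsq
        have hev := (hasDerivAt_iff_tendsto_slope.1 hsq).mono_left
          (nhdsWithin_mono x (fun z (hz : z ∈ Set.Ioi x) => ne_of_gt hz))
        filter_upwards [hev.eventually (gt_mem_nhds hr), self_mem_nhdsWithin] with z hz hzx
        exact (hslope z hzx).trans_lt hz
    · have : 0 ≤ 3 / τ * s' ^ 2 := by positivity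
      linarith
    · exact Continuous.continuousOn (by fun_prop)
    · intro x hx
      have := ((hasDerivAt_id x).const_mul η).add (((hasDerivAt_id x).pow 2).const_mul (3 / τ))
      simp only [id, mul_one, Nat.cast_ofNat, Nat.add_one_sub_one, pow_one] at this
      exact this.hasDerivWithinAt
    · intro x hx hxB
      have hx0 : 0 < x := hs'0.trans_le hx.1
      set w := a + x • u - P x with hw
      have hfx : Metric.infDist (a + x • u) S = ‖w‖ := by
        rw [← (hP x).2, dist_eq_norm]
      simp only [hfx] at hxB
      have hwpos : 0 < ‖w‖ := by rw [hxB]; positivity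
      rw [if_neg hwpos.ne', div_lt_iff₀ hwpos]
      have hwx : ‖w‖ ≤ x := by
        have := (hP x).dist_le ha
        rw [dist_eq_norm, dist_eq_norm, add_sub_cancel_left, norm_smul, hu1, mul_one,
          Real.norm_eq_abs, abs_of_pos hx0] at this
        exact this
      have hac : a - P x = w - x • u := by rw [hw]; abel
      have hacn : ‖a - P x‖ ≤ 2 * x := by
        rw [hac]
        refine (norm_sub_le _ _).trans ?_
        rw [norm_smul, hu1, mul_one, Real.norm_eq_abs, abs_of_pos hx0]
        linarith
      have h3 := (abs_le.1 (hS.abs_inner_le (hP x).1 ha (hP x).sub_mem_orthogonal)).1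
      rw [← hw] at h3
      have h4 : inner ℝ (a - P x) w = ‖w‖ ^ 2 - x * inner ℝ w u := by
        rw [hac, inner_sub_left, real_inner_self_eq_norm_sq, real_inner_smul_left,
          real_inner_comm u w]
      rw [h4] at h3
      have h5 : ‖a - P x‖ ^ 2 / (2 * τ) * ‖w‖ ≤ (2 * x) ^ 2 / (2 * τ) * ‖w‖ := by gcongr
      have h6 : x * inner ℝ w u < x * ((η + 3 / τ * (2 * x)) * ‖w‖) := by
        have h7 : ‖w‖ ^ 2 = (η * x + 3 / τ * x ^ 2) * ‖w‖ := by rw [sq]; nth_rw 1 [hxB]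
        have h8 : 0 < x ^ 2 / τ * ‖w‖ := by positivity
        have h9 : (2 * x) ^ 2 / (2 * τ) * ‖w‖ = 2 * (x ^ 2 / τ * ‖w‖) := by field_simp
        have h10 : x * ((η + 3 / τ * (2 * x)) * ‖w‖)
            = (η * x + 3 / τ * x ^ 2) * ‖w‖ + 3 * (x ^ 2 / τ * ‖w‖) := by ring
        linarith
      exact lt_of_mul_lt_mul_left h6 hx0.le
  have hlim : Filter.Tendsto (fun η : ℝ => η * s + 3 / τ * s ^ 2) (𝓝[>] 0)
      (𝓝 (0 * s + 3 / τ * s ^ 2)) := by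
    have : Continuous fun η : ℝ => η * s + 3 / τ * s ^ 2 := by fun_prop
    exact (this.tendsto 0).mono_left nhdsWithin_le_nhds
  have := ge_of_tendsto hlim (by filter_upwards [self_mem_nhdsWithin] with η hη using main η hη)
  rw [zero_mul, zero_add] at this
  rwa [mul_div_right_comm]

/-- Tangent spaces of `S` vary in a Lipschitz way. -/
theorem abs_inner_tangent_normal_le (hS : IsReachManifold d S τ) {a q u ν : Amb D} (ha : a ∈ S)
    (hq : q ∈ S) (hu : u ∈ tangentSubspace S q) (hν : ν ∈ (tangentSubspace S a)ᗮ) :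
    |inner ℝ u ν| ≤ 8 * ‖q - a‖ / τ * (‖u‖ * ‖ν‖) := by
  have hτ := hS.pos
  rcases eq_or_ne q a with rfl | hqa
  · rw [(Submodule.mem_orthogonal _ _).1 hν u hu]
    simp
  rcases eq_or_ne u 0 with rfl | hu0
  · simp
  have hℓ : 0 < ‖q - a‖ := norm_pos_iff.2 (sub_ne_zero.2 hqa)
  set ℓ := ‖q - a‖ with hℓd
  have hun : 0 < ‖u‖ := norm_pos_iff.2 hu0
  have hunit : ‖‖u‖⁻¹ • u‖ = 1 := by
    rw [norm_smul, norm_inv, norm_norm, inv_mul_cancel₀ hun.ne']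
  set e := ‖u‖⁻¹ • u with he
  have hd := hS.infDist_add_smul_le hq (Submodule.smul_mem _ ‖u‖⁻¹ hu) hunit hℓ
  rw [← he] at hd
  obtain ⟨c, hc⟩ := hS.compact.exists_isNearestPoint hS.nonempty (q + ℓ • e)
  have hcq := hc.dist_le hq
  rw [← hc.2, dist_eq_norm] at hd
  rw [dist_eq_norm, dist_eq_norm, add_sub_cancel_left, norm_smul, hunit, mul_one,
    Real.norm_eq_abs, abs_of_pos hℓ] at hcq
  have hle : ‖ℓ • e‖ = ℓ := by
    rw [norm_smul, hunit, mul_one, Real.norm_eq_abs, abs_of_pos hℓ]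
  have hca : ‖c - a‖ ≤ 3 * ℓ := by
    have : c - a = -(q + ℓ • e - c) + ((q - a) + ℓ • e) := by abel
    rw [this]
    refine (norm_add_le _ _).trans ?_
    rw [norm_neg]
    have := norm_add_le (q - a) (ℓ • e)
    rw [hle] at this
    linarith
  have h1 := hS.abs_inner_le ha hc.1 hν
  have h2 := hS.abs_inner_le ha hq hν
  have h3 : |inner ℝ (q + ℓ • e - c) ν| ≤ 3 * ℓ ^ 2 / τ * ‖ν‖ :=
    (abs_real_inner_le_norm _ _).trans (by gcongr)
  -- Go along the tangent line at `q` for length `ℓ = ‖q - a‖` and drop to the foot `c`. The three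
  -- terms cost `3`, `9/2` and `1/2` times `ℓ²‖ν‖/τ`, which gives the constant `8`.
  have h4 : ℓ * inner ℝ e ν = inner ℝ (q + ℓ • e - c) ν + inner ℝ (c - a) ν - inner ℝ (q - a) ν := by
    rw [← inner_add_left, ← inner_sub_left, ← real_inner_smul_left]
    congr 1
    abel
  have h5 : ‖c - a‖ ^ 2 / (2 * τ) * ‖ν‖ ≤ (3 * ℓ) ^ 2 / (2 * τ) * ‖ν‖ := by gcongr
  have h6 : ℓ * |inner ℝ e ν| ≤ ℓ * (8 * ℓ / τ * ‖ν‖) := by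
    rw [← abs_of_pos hℓ, ← abs_mul, abs_of_pos hℓ, h4]
    refine (abs_sub _ _).trans ?_
    refine (add_le_add_left (abs_add_le _ _) _).trans ?_
    have e1 : (3 * ℓ) ^ 2 / (2 * τ) * ‖ν‖ = 9 / 2 * (ℓ ^ 2 / τ * ‖ν‖) := by field_simp; ring
    have e2 : ℓ ^ 2 / (2 * τ) * ‖ν‖ = 1 / 2 * (ℓ ^ 2 / τ * ‖ν‖) := by field_simp
    have e3 : ℓ * (8 * ℓ / τ * ‖ν‖) = 8 * (ℓ ^ 2 / τ * ‖ν‖) := by ring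
    have e4 : 3 * ℓ ^ 2 / τ * ‖ν‖ = 3 * (ℓ ^ 2 / τ * ‖ν‖) := by ring
    rw [← hℓd] at h2
    linarith
  have h7 := le_of_mul_le_mul_left h6 hℓ
  have h8 : inner ℝ u ν = ‖u‖ * inner ℝ e ν := by
    rw [he, real_inner_smul_left]; field_simp
  rw [h8, abs_mul, abs_of_pos hun]
  calc ‖u‖ * |inner ℝ e ν| ≤ ‖u‖ * (8 * ℓ / τ * ‖ν‖) := by gcongr
    _ = _ := by ring

end IsReachManifold

end

/-! ### Fibres of the tube over a tangent space. -/

section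

variable {D : ℕ} {S : Set (Amb D)} {τ : ℝ}

theorem norm_starProjection_le_of_inner (T : Submodule ℝ (Amb D)) {w : Amb D} {C : ℝ}
    (hC : 0 ≤ C) (h : ∀ u ∈ T, |inner ℝ u w| ≤ C * ‖u‖) : ‖T.starProjection w‖ ≤ C := by
  have h1 := h _ (T.starProjection_apply_mem w)
  have h2 : inner ℝ (T.starProjection w) w = ‖T.starProjection w‖ ^ 2 := by
    simpa using T.re_inner_starProjection_eq_normSq w
  rw [h2, abs_of_nonneg (sq_nonneg _), sq] at h1
  rcases (norm_nonneg (T.starProjection w)).eq_or_lt with h0 | h0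
  · rwa [← h0]
  · exact le_of_mul_le_mul_right h1 h0

namespace IsReachManifold

variable {d : ℕ}

section Fibres

variable {a t c : Amb D} {σ ρ : ℝ}

/-- The tangent line estimate at length `2ρ`: `3(2ρ)²/τ = 12σ`. Working with the foot of `a + t`
avoids proving that `S` is locally a graph over its tangent space. -/
theorem norm_add_sub_nearest_le (hS : IsReachManifold d S τ) (ha : a ∈ S)
    (hρ : ρ ^ 2 = σ * τ) (ht : t ∈ tangentSubspace S a) (htρ : ‖t‖ ≤ 2 * ρ)
    (hc : IsNearestPoint S (a + t) c) : ‖a + t - c‖ ≤ 12 * σ := by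
  have hτ := hS.pos
  have hσ : 0 ≤ σ := by
    have : 0 ≤ σ * τ := hρ ▸ sq_nonneg ρ
    exact nonneg_of_mul_nonneg_left this hτ
  rcases eq_or_ne t 0 with rfl | h0
  · have := hc.dist_le ha
    rw [add_zero, dist_self] at this
    rw [add_zero, ← dist_eq_norm]
    linarith
  have hn : 0 < ‖t‖ := norm_pos_iff.2 h0
  have hunit : ‖‖t‖⁻¹ • t‖ = 1 := by
    rw [norm_smul, norm_inv, norm_norm, inv_mul_cancel₀ hn.ne']
  have h := hS.infDist_add_smul_le ha (Submodule.smul_mem _ ‖t‖⁻¹ ht) hunit hn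
  rw [smul_inv_smul₀ hn.ne', ← hc.2, dist_eq_norm] at h
  refine h.trans ?_
  rw [div_le_iff₀ hτ]
  have : ‖t‖ ^ 2 ≤ (2 * ρ) ^ 2 := by gcongr
  nlinarith

theorem norm_nearest_sub_le (ha : a ∈ S) (htρ : ‖t‖ ≤ 2 * ρ)
    (hc : IsNearestPoint S (a + t) c) : ‖c - a‖ ≤ 4 * ρ := by
  have h := hc.dist_le ha
  rw [dist_eq_norm, dist_eq_norm, add_sub_cancel_left] at h
  have : c - a = t - (a + t - c) := by abel
  rw [this]
  refine (norm_sub_le _ _).trans ?_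
  linarith

/-- The foot of a point of the tangent space lies almost below it. -/
theorem norm_lateral_le (hS : IsReachManifold d S τ) (ha : a ∈ S)
    (hρ : ρ ^ 2 = σ * τ) (ht : t ∈ tangentSubspace S a) (htρ : ‖t‖ ≤ 2 * ρ)
    (hc : IsNearestPoint S (a + t) c) :
    ‖(tangentSubspace S a).starProjection (a + t - c)‖ ≤ 384 * (ρ / τ) * σ := by
  have hτ := hS.pos
  have h1 := hS.norm_add_sub_nearest_le ha hρ ht htρ hc
  have h2 := norm_nearest_sub_le ha htρ hc
  have hρ0 : 0 ≤ ρ := by have := (norm_nonneg _).trans htρ; linarith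
  have hσ0 : 0 ≤ σ := by
    have := (norm_nonneg _).trans h1
    linarith
  refine norm_starProjection_le_of_inner _ (by positivity) fun u hu => ?_
  refine (hS.abs_inner_tangent_normal_le hc.1 ha hu hc.sub_mem_orthogonal).trans ?_
  rw [norm_sub_rev a c]
  calc 8 * ‖c - a‖ / τ * (‖u‖ * ‖a + t - c‖) ≤ 8 * (4 * ρ) / τ * (‖u‖ * (12 * σ)) := by gcongr
    _ = _ := by ring

/-- Near `a` the fibre of the tube over `t` lies in a ball of radius little more than `σ`. -/
theorem norm_normal_le (hS : IsReachManifold d S τ) (ha : a ∈ S) (hσ : 0 < σ) (hσρ : σ ≤ ρ)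
    (hρ : ρ ^ 2 = σ * τ) (hsmall : 384 * (ρ / τ) ≤ 1) {x c' : Amb D} (hc' : c' ∈ S)
    (hxc' : ‖x - c'‖ ≤ σ) (hxa : ‖x - a‖ ≤ 2 * ρ)
    (hc : IsNearestPoint S (a + (tangentSubspace S a).starProjection (x - a)) c) :
    ‖(tangentSubspace S a)ᗮ.starProjection (x - c)‖ ≤ (1 + 384 * (ρ / τ)) * σ := by
  have hτ := hS.pos
  have hρ0 : 0 ≤ ρ := hσ.le.trans hσρ
  set T := tangentSubspace S a with hT
  set t := T.starProjection (x - a) with ht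
  have htT : t ∈ T := T.starProjection_apply_mem _
  have htρ : ‖t‖ ≤ 2 * ρ := (T.norm_starProjection_apply_le _).trans hxa
  have h2 := norm_nearest_sub_le ha htρ hc
  have h3 := hS.norm_lateral_le ha hρ htT htρ hc
  have hlat : T.starProjection (a + t - c) = T.starProjection (x - c) := by
    have e1 : a + t - c = (x - c) - (x - a - t) := by abel
    have e2 : T.starProjection (x - a - t) = 0 :=
      (T.starProjection_apply_eq_zero_iff).2 (T.sub_starProjection_mem_orthogonal _)
    rw [e1, map_sub, e2, sub_zero]
  rw [← hT, hlat] at h3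
  have h3' : ‖T.starProjection (x - c)‖ ≤ σ := h3.trans (by nlinarith)
  have hPT : ‖T.starProjection (c' - c)‖ ≤ 2 * σ := by
    have : c' - c = (x - c) - (x - c') := by abel
    rw [this, map_sub]
    refine (norm_sub_le _ _).trans ?_
    have := (T.norm_starProjection_apply_le (x - c')).trans hxc'
    linarith
  have hcc : ‖c' - c‖ ≤ 7 * ρ := by
    have : c' - c = (x - a) - (x - c') - (c - a) := by abel
    rw [this]
    refine (norm_sub_le _ _).trans ?_
    have := norm_sub_le (x - a) (x - c')
    linarith
  have hPN : ‖Tᗮ.starProjection (c' - c)‖ ≤ 36 * (ρ / τ) * ‖c' - c‖ := by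
    refine norm_starProjection_le_of_inner _ (by positivity) fun ν hν => ?_
    set Tc := tangentSubspace S c
    have hsplit := Tc.starProjection_add_starProjection_orthogonal ν
    have hi : inner ℝ ν (c' - c) = inner ℝ (Tc.starProjection ν) (c' - c)
        + inner ℝ (c' - c) (Tcᗮ.starProjection ν) := by
      rw [real_inner_comm (Tcᗮ.starProjection ν), ← inner_add_left, hsplit]
    have hb1 : ‖Tc.starProjection ν‖ ≤ 32 * (ρ / τ) * ‖ν‖ := by
      refine norm_starProjection_le_of_inner _ (by positivity) fun u hu => ?_
      refine (hS.abs_inner_tangent_normal_le ha hc.1 hu hν).trans ?_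
      calc 8 * ‖c - a‖ / τ * (‖u‖ * ‖ν‖) ≤ 8 * (4 * ρ) / τ * (‖u‖ * ‖ν‖) := by gcongr
        _ = _ := by ring
    have hb2 := hS.abs_inner_le hc.1 hc' (Tcᗮ.starProjection_apply_mem ν)
    have hb3 : ‖Tcᗮ.starProjection ν‖ ≤ ‖ν‖ := Tcᗮ.norm_starProjection_apply_le ν
    rw [hi]
    refine (abs_add_le _ _).trans ?_
    have hb4 : |inner ℝ (Tc.starProjection ν) (c' - c)| ≤ 32 * (ρ / τ) * ‖ν‖ * ‖c' - c‖ :=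
      (abs_real_inner_le_norm _ _).trans (by gcongr)
    have hb5 : ‖c' - c‖ ^ 2 / (2 * τ) * ‖Tcᗮ.starProjection ν‖
        ≤ (‖c' - c‖ * (7 * ρ)) / (2 * τ) * ‖ν‖ := by
      rw [sq]; gcongr
    have hb6 : 0 ≤ ρ / τ * ‖ν‖ * ‖c' - c‖ := by
      positivity
    have hb7 : (‖c' - c‖ * (7 * ρ)) / (2 * τ) * ‖ν‖ = 7 / 2 * (ρ / τ * ‖ν‖ * ‖c' - c‖) := by
      field_simp
    nlinarith
  -- Bootstrap: the crude bound `7ρ` made the normal part of `c' - c` a small multiple of `‖c' -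
  -- c‖`, so it is absorbed and only the tangential part `2σ` counts. Then `36 · 4 = 144` fits
  -- within `384`.
  have hnorm : ‖c' - c‖ ≤ 4 * σ := by
    have h := norm_add_le (T.starProjection (c' - c)) (Tᗮ.starProjection (c' - c))
    rw [T.starProjection_add_starProjection_orthogonal] at h
    have h' : 36 * (ρ / τ) * ‖c' - c‖ ≤ 1 / 2 * ‖c' - c‖ := by gcongr; linarith
    linarith
  have hsum : x - c = (x - c') + (c' - c) := by abel
  rw [hsum, map_add]
  refine (norm_add_le _ _).trans ?_
  have h5 := (Tᗮ.norm_starProjection_apply_le (x - c')).trans hxc'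
  have h6 : 36 * (ρ / τ) * ‖c' - c‖ ≤ 36 * (ρ / τ) * (4 * σ) := by
    gcongr
  have h7 : 0 ≤ ρ / τ * σ := by
    positivity
  nlinarith

/-- Near `a` the fibre of the tube over `t` contains a ball of radius little less than `σ`. -/
theorem norm_sub_lt_of_fibre (hS : IsReachManifold d S τ) (ha : a ∈ S)
    (hρ : ρ ^ 2 = σ * τ) (ht : t ∈ tangentSubspace S a) (htρ : ‖t‖ ≤ 2 * ρ)
    (hc : IsNearestPoint S (a + t) c) {y : Amb D}
    (hyc : ‖y - (tangentSubspace S a)ᗮ.starProjection (c - a)‖ < (1 - 384 * (ρ / τ)) * σ) :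
    ‖a + t + y - c‖ < σ := by
  set T := tangentSubspace S a
  have h3 := hS.norm_lateral_le ha hρ ht htρ hc
  have e1 : T.starProjection (a + t - c) = t - T.starProjection (c - a) := by
    rw [show a + t - c = t - (c - a) by abel, map_sub, (T.starProjection_eq_self_iff).2 ht]
  have e2 : a + t + y - c = T.starProjection (a + t - c) + (y - Tᗮ.starProjection (c - a)) := by
    rw [e1]
    have := T.starProjection_add_starProjection_orthogonal (c - a)
    rw [show a + t + y - c = t + y - (c - a) by abel]
    nth_rw 1 [← this]
    abel
  rw [e2]
  refine (norm_add_le _ _).trans_lt ?_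
  linarith

end Fibres

end IsReachManifold

end

/-! ### Volumes of caps of the tube. -/

section

variable {D : ℕ}

theorem measurePreserving_add_subspace (T : Submodule ℝ (Amb D)) (a : Amb D) :
    MeasurePreserving (fun z : T × Tᗮ => a + (z.1 : Amb D) + (z.2 : Amb D))
      ((volume : Measure T).prod (volume : Measure Tᗮ)) volume := by
  have h1 := T.orthogonalDecomposition.symm.measurePreserving
  have h2 : MeasurePreserving (WithLp.toLp 2 : T × Tᗮ → WithLp 2 (T × Tᗮ))
      ((volume : Measure T).prod (volume : Measure Tᗮ)) volume := WithLp.volume_preserving_toLp _ _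
  have h3 := (measurePreserving_add_left (volume : Measure (Amb D)) a).comp (h1.comp h2)
  convert! h3 using 1
  funext z
  simp [add_assoc]

/-- Volume of a set fibred over a subspace, bounded below by the volumes of the fibres. -/
theorem le_volume_of_fibres (T : Submodule ℝ (Amb D)) (a : Amb D) {E : Set (Amb D)}
    (hE : MeasurableSet E) {B : Set T} (hB : MeasurableSet B) (y : T → Tᗮ) (R : ℝ)
    (h : ∀ t ∈ B, ∀ z : Tᗮ, ‖z - y t‖ < R → a + (t : Amb D) + (z : Amb D) ∈ E) :
    volume B * volume (Metric.ball (0 : Tᗮ) R) ≤ volume E := by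
  have hm := measurePreserving_add_subspace T a
  rw [← hm.measure_preimage hE.nullMeasurableSet, Measure.prod_apply (hm.measurable hE), mul_comm,
    ← setLIntegral_const, ← lintegral_indicator hB]
  refine lintegral_mono fun t => ?_
  by_cases ht : t ∈ B
  · rw [Set.indicator_of_mem ht, ← Measure.addHaar_ball_center volume (y t)]
    refine measure_mono fun z hz => ?_
    rw [Metric.mem_ball, dist_eq_norm] at hz
    exact h t ht z hz
  · rw [Set.indicator_of_notMem ht]
    exact zero_le

/-- By Fubini and translation invariance only the radius of the fibre balls matters, so the centres
`y` need not depend measurably on `t`. -/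
theorem volume_le_of_fibres (T : Submodule ℝ (Amb D)) (a : Amb D) {E : Set (Amb D)}
    (hE : MeasurableSet E) {B : Set T} (hB : MeasurableSet B) (y : T → Tᗮ) (R : ℝ)
    (h : ∀ t : T, ∀ z : Tᗮ, a + (t : Amb D) + (z : Amb D) ∈ E → t ∈ B ∧ ‖z - y t‖ ≤ R) :
    volume E ≤ volume B * volume (Metric.closedBall (0 : Tᗮ) R) := by
  have hm := measurePreserving_add_subspace T a
  rw [← hm.measure_preimage hE.nullMeasurableSet, Measure.prod_apply (hm.measurable hE), mul_comm,
    ← setLIntegral_const, ← lintegral_indicator hB]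
  refine lintegral_mono fun t => ?_
  by_cases ht : t ∈ B
  · rw [Set.indicator_of_mem ht, ← Measure.addHaar_closedBall_center volume (y t)]
    refine measure_mono fun z hz => ?_
    rw [Metric.mem_closedBall, dist_eq_norm]
    exact (h t z hz).2
  · rw [Set.indicator_of_notMem ht]
    refine (measure_mono_null (t := ∅) (fun z hz => ht (h t z hz).1) measure_empty).le

theorem starProjection_add_normal (T : Submodule ℝ (Amb D)) (t : T) (z : Tᗮ) :
    T.starProjection ((t : Amb D) + z) = t := by
  rw [map_add, (T.starProjection_eq_self_iff).2 t.2, (T.starProjection_apply_eq_zero_iff).2 z.2,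
    add_zero]

/-- Bernoulli gives `(1 - η)^m ≥ 3/4`, and `(1 + η)^m (1 - η)^m ≤ 1`. This is where smallness
relative to `D` is spent. -/
theorem half_pow_le_pow {η : ℝ} (D : ℕ) (hη0 : 0 ≤ η) (hη : η * (4 * (D + 1)) ≤ 1) {m : ℕ}
    (hm : m ≤ D) : 1 / 2 * (1 + η) ^ m ≤ (1 - η) ^ m := by
  have hmD : (m : ℝ) ≤ D := by exact_mod_cast hm
  have hη1 : η ≤ 1 / 4 := by nlinarith
  have h1 := one_add_mul_le_pow (a := -η) (by linarith) m
  rw [← sub_eq_add_neg] at h1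
  have h2 : (3 : ℝ) / 4 ≤ (1 - η) ^ m := by nlinarith
  have h3 : (1 + η) ^ m * (1 - η) ^ m ≤ 1 := by
    rw [← mul_pow]
    exact pow_le_one₀ (by nlinarith) (by nlinarith)
  have h4 : 0 ≤ (1 + η) ^ m := by positivity
  nlinarith

/-- The proportion of the region of interest lying over a ball of radius `ρ / (8 (d + 1))` of the
tangent space. -/
noncomputable def capRatio (d : ℕ) : ℝ := (1 / (16 * (d + 1))) ^ d / 4

theorem capRatio_pos (d : ℕ) : 0 < capRatio d := by unfold capRatio; positivity

theorem capRatio_le (d : ℕ) : capRatio d ≤ 1 / 4 := by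
  unfold capRatio
  have : (1 / (16 * ((d : ℝ) + 1))) ^ d ≤ 1 := by
    refine pow_le_one₀ (by positivity) ?_
    rw [div_le_one (by positivity)]
    have : (0 : ℝ) ≤ d := d.cast_nonneg
    linarith
  linarith

/-- The part of the region of interest about `r` lying over a small ball of the tangent space. -/
def tubeCap (d : ℕ) (S : Set (Amb D)) (σ ρ : ℝ) (r a e : Amb D) : Set (Amb D) :=
  (Metric.thickening σ S ∩ Metric.ball r ρ) ∩
    {x | ‖(tangentSubspace S a).starProjection (x - a) - (ρ / 2) • e‖ < ρ / (8 * (d + 1))}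

theorem isOpen_tubeCap (d : ℕ) (S : Set (Amb D)) (σ ρ : ℝ) (r a e : Amb D) :
    IsOpen (tubeCap d S σ ρ r a e) := by
  refine (Metric.isOpen_thickening.inter Metric.isOpen_ball).inter
    (isOpen_lt ?_ continuous_const)
  fun_prop

namespace IsReachManifold

/-- The region of interest sits over a ball of radius `2ρ` of `T` with fibres of radius at most `(1
+ η)σ`; the cap sits over a ball of radius `ρ/(8(d+1))` and contains fibres of radius `(1 - η)σ`.
The powers of `σ` cancel. The factor `2` is slack for the sampling error. -/
theorem volume_tubeCap_ge {d : ℕ} {S : Set (Amb D)} {τ σ ρ : ℝ} (hS : IsReachManifold d S τ)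
    (hσ : 0 < σ) (hρ0 : 0 < ρ) (hρ : ρ ^ 2 = σ * τ) (hbig : 1536 * (D + 1) * σ ≤ ρ)
    {r a e : Amb D} (hra : IsNearestPoint S r a) (hr : ‖r - a‖ < σ)
    (he : e ∈ tangentSubspace S a) (he1 : ‖e‖ = 1) :
    ENNReal.ofReal (2 * capRatio d) * volume (Metric.thickening σ S ∩ Metric.ball r ρ)
      ≤ volume (tubeCap d S σ ρ r a e) := by
  have ha := hra.1
  have hτ := hS.pos
  have hD0 : (0 : ℝ) ≤ D := D.cast_nonneg
  have hσρ : 1536 * σ ≤ ρ := by nlinarith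
  obtain ⟨ch⟩ := hS.chart a ha
  have hfin := ch.finrank_tangentSubspace ha
  set T := tangentSubspace S a with hT
  have hratio : ρ / τ = σ / ρ := by rw [div_eq_div_iff hτ.ne' hρ0.ne', ← hρ]; ring
  set η := 384 * (ρ / τ) with hη
  have hη0 : 0 ≤ η := by positivity
  have hηD : η * (4 * (D + 1)) ≤ 1 := by
    have : η * (4 * (D + 1)) = (1536 * (D + 1) * σ) / ρ := by rw [hη, hratio]; ring
    rw [this, div_le_one hρ0]
    exact hbig
  have hη4 : η ≤ 1 / 4 := by nlinarith
  have hη1 : η ≤ 1 := by linarith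
  choose c hc using fun t : T => hS.compact.exists_isNearestPoint hS.nonempty (a + (t : Amb D))
  let y : T → Tᗮ := fun t => ⟨Tᗮ.starProjection (c t - a), Tᗮ.starProjection_apply_mem _⟩
  have hU := volume_le_of_fibres T a
    (E := Metric.thickening σ S ∩ Metric.ball r ρ)
    (Metric.isOpen_thickening.inter Metric.isOpen_ball).measurableSet
    (B := Metric.closedBall 0 (2 * ρ)) Metric.isClosed_closedBall.measurableSet y ((1 + η) * σ) (by
      intro t z hx
      obtain ⟨hx1, hx2⟩ := hx
      obtain ⟨c', hc', hxc'⟩ := Metric.mem_thickening_iff.1 hx1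
      rw [Metric.mem_ball, dist_eq_norm] at hx2
      rw [dist_eq_norm] at hxc'
      have hxa' : a + (t : Amb D) + z - a = t + z := by abel
      have hxa : ‖(t : Amb D) + z‖ ≤ 2 * ρ := by
        have : (t : Amb D) + z = (a + t + z - r) + (r - a) := by abel
        rw [this]
        refine (norm_add_le _ _).trans ?_
        linarith
      have hproj := starProjection_add_normal T t z
      constructor
      · rw [mem_closedBall_zero_iff, Submodule.coe_norm, ← hproj]
        exact (T.norm_starProjection_apply_le _).trans hxa
      · have h := hS.norm_normal_le ha hσ (by linarith) hρ hη1 hc' hxc'.le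
          (by rw [hxa']; exact hxa) (c := c t) (by rw [← hT, hxa', hproj]; exact hc t)
        rw [← hT] at h
        have hs : Tᗮ.starProjection (a + (t : Amb D) + z - c t) = z - Tᗮ.starProjection (c t - a) := by
          rw [show a + (t : Amb D) + z - c t = t + z - (c t - a) by abel, map_sub, map_add,
            (Tᗮ.starProjection_eq_self_iff).2 z.2, (Tᗮ.starProjection_apply_eq_zero_iff).2
              (T.le_orthogonal_orthogonal t.2), zero_add]
        rw [hs] at h
        exact h)
  have hA := le_volume_of_fibres T a (isOpen_tubeCap d S σ ρ r a e).measurableSet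
    (B := Metric.ball ((ρ / 2) • ⟨e, he⟩) (ρ / (8 * (d + 1)))) Metric.isOpen_ball.measurableSet
    y ((1 - η) * σ) (by
      intro t ht z hz
      rw [Metric.mem_ball, dist_eq_norm, Submodule.coe_norm] at ht
      simp only [Submodule.coe_sub, Submodule.coe_smul] at ht
      have hle : ρ / (8 * (d + 1)) ≤ ρ / 8 := by
        apply div_le_div_of_nonneg_left hρ0.le (by norm_num)
        have : (0 : ℝ) ≤ d := d.cast_nonneg
        linarith
      have htn : ‖(t : Amb D)‖ ≤ 5 / 8 * ρ := by
        have h := norm_add_le ((t : Amb D) - (ρ / 2) • e) ((ρ / 2) • e)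
        rw [sub_add_cancel, norm_smul, he1, mul_one, Real.norm_eq_abs,
          abs_of_pos (half_pos hρ0)] at h
        linarith
      have hzc : ‖(z : Amb D) - Tᗮ.starProjection (c t - a)‖ < (1 - η) * σ := hz
      have h1 := hS.norm_sub_lt_of_fibre ha hρ t.2 (by linarith) (hc t) hzc
      have h2 := hS.norm_add_sub_nearest_le ha hρ t.2 (by linarith) (hc t)
      refine ⟨⟨Metric.mem_thickening_iff.2 ⟨c t, (hc t).1, by rwa [dist_eq_norm]⟩, ?_⟩, ?_⟩
      · rw [Metric.mem_ball, dist_eq_norm]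
        have : a + (t : Amb D) + z - r = (a + t + z - c t) - (a + t - c t) + t - (r - a) := by abel
        rw [this]
        refine (norm_sub_le _ _).trans_lt ?_
        have h3 := norm_add_le ((a + (t : Amb D) + z - c t) - (a + t - c t)) t
        have h4 := norm_sub_le (a + (t : Amb D) + z - c t) (a + t - c t)
        linarith
      · change ‖T.starProjection (a + (t : Amb D) + z - a) - (ρ / 2) • e‖ < ρ / (8 * (d + 1))
        rw [show a + (t : Amb D) + z - a = t + z by abel, starProjection_add_normal]
        exact ht)
  refine (mul_le_mul_right hU _).trans (le_trans ?_ hA)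
  have hη' : 0 < (1 - η) * σ := mul_pos (by linarith) hσ
  rw [Measure.addHaar_closedBall _ _ (by positivity), Measure.addHaar_closedBall _ _ (by positivity),
    Measure.addHaar_ball_of_pos _ _ (show 0 < ρ / (8 * ((d : ℝ) + 1)) by positivity),
    Measure.addHaar_ball_of_pos _ (0 : Tᗮ) hη', hfin]
  set m := Module.finrank ℝ Tᗮ with hm
  have hmD : m ≤ D := by
    have := T.finrank_add_finrank_orthogonal
    simp only [finrank_euclideanSpace, Fintype.card_fin] at this
    omega
  set V₁ := volume (Metric.ball (0 : T) 1)
  set V₂ := volume (Metric.ball (0 : Tᗮ) 1)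
  have e1 : ENNReal.ofReal (2 * capRatio d) * (ENNReal.ofReal ((2 * ρ) ^ d) * V₁ *
      (ENNReal.ofReal (((1 + η) * σ) ^ m) * V₂)) = ENNReal.ofReal (2 * capRatio d * ((2 * ρ) ^ d *
        ((1 + η) * σ) ^ m)) * (V₁ * V₂) := by
    have hcap := capRatio_pos d
    rw [ENNReal.ofReal_mul (p := 2 * capRatio d) (by positivity),
      ENNReal.ofReal_mul (p := (2 * ρ) ^ d) (by positivity)]
    ac_rfl
  have e2 : ENNReal.ofReal ((ρ / (8 * (d + 1))) ^ d) * V₁ *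
      (ENNReal.ofReal (((1 - η) * σ) ^ m) * V₂) =
      ENNReal.ofReal ((ρ / (8 * (d + 1))) ^ d * ((1 - η) * σ) ^ m) * (V₁ * V₂) := by
    rw [ENNReal.ofReal_mul (by positivity)]
    ac_rfl
  rw [e1, e2]
  refine mul_le_mul_left (ENNReal.ofReal_le_ofReal ?_) _
  have hpow := half_pow_le_pow D hη0 hηD hmD
  have e3 : (ρ / (8 * (d + 1))) ^ d = (1 / (16 * ((d : ℝ) + 1))) ^ d * (2 * ρ) ^ d := by
    rw [← mul_pow]; congr 1; field_simp; norm_num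
  rw [e3, mul_pow (1 + η), mul_pow (1 - η), capRatio]
  have hq : 0 ≤ (1 / (16 * ((d : ℝ) + 1))) ^ d * (2 * ρ) ^ d * σ ^ m := by positivity
  nlinarith [mul_le_mul_of_nonneg_left hpow hq]

end IsReachManifold

end

/-! ### Sampling. -/

/-- Chebyshev's bound for the sign of a sum of independent bounded variables of positive mean. -/
theorem pi_sum_nonpos_le {E : Type*} [MeasurableSpace E] (μ : Measure E) [IsProbabilityMeasure μ]
    {n : ℕ} (hn : 0 < n) {f : E → ℝ} (hf : Measurable f) (hf1 : ∀ x, |f x| ≤ 1) {m : ℝ}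
    (hm : 0 < m) (hmean : m ≤ ∫ x, f x ∂μ) :
    (Measure.pi fun _ : Fin n => μ) {X | ∑ i, f (X i) ≤ 0} ≤ ENNReal.ofReal (1 / (n * m ^ 2)) := by
  have hn' : (0 : ℝ) < n := by exact_mod_cast hn
  have hL : MemLp f 2 μ :=
    MemLp.of_bound hf.aestronglyMeasurable 1 (Filter.Eventually.of_forall hf1)
  have hY : MemLp (∑ i : Fin n, fun X : Fin n → E => f (X i)) 2 (Measure.pi fun _ : Fin n => μ) :=
    memLp_finsetSum' _ fun i _ => hL.comp_measurePreserving (measurePreserving_eval _ i)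
  have hvar : ProbabilityTheory.variance (∑ i : Fin n, fun X : Fin n → E => f (X i))
      (Measure.pi fun _ : Fin n => μ) ≤ n := by
    rw [ProbabilityTheory.variance_sum_pi (fun _ => hL), Finset.sum_const, Finset.card_univ,
      Fintype.card_fin, nsmul_eq_mul]
    have := ProbabilityTheory.variance_le_sq_of_bounded (μ := μ) (a := -1) (b := 1)
      (Filter.Eventually.of_forall fun x => abs_le.1 (hf1 x)) hf.aemeasurable
    norm_num at this
    nlinarith
  have hint : ∫ X, (∑ i : Fin n, fun X : Fin n → E => f (X i)) X ∂(Measure.pi fun _ : Fin n => μ)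
      = n * ∫ x, f x ∂μ := by
    simp only [Finset.sum_apply]
    rw [integral_finsetSum]
    · simp only [integral_comp_eval (μ := fun _ : Fin n => μ) hf.aestronglyMeasurable]
      simp
    · intro i _
      exact (hL.comp_measurePreserving (measurePreserving_eval _ i)).integrable one_le_two
  have hch := ProbabilityTheory.meas_ge_le_variance_div_sq hY (mul_pos hn' hm)
  refine (measure_mono ?_).trans (hch.trans (ENNReal.ofReal_le_ofReal ?_))
  · intro X hX
    have hX' : ∑ i, f (X i) ≤ 0 := hX
    change (n : ℝ) * m ≤ |(∑ i : Fin n, fun X : Fin n → E => f (X i)) X - _|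
    rw [hint, Finset.sum_apply, abs_sub_comm]
    refine le_trans ?_ (le_abs_self _)
    have : (n : ℝ) * m ≤ n * ∫ x, f x ∂μ := by gcongr
    linarith
  · rw [div_le_div_iff₀ (by positivity) (by positivity)]
    calc _ ≤ (n : ℝ) * (n * m ^ 2) := by gcongr
      _ = _ := by ring

/-- Union bound over the finitely many `f j`, together with removal of the null event that some
sample leaves `V`. -/
theorem exists_event_sum_pos {E ι : Type*} [MeasurableSpace E] [Fintype ι] (μ : Measure E)
    [IsProbabilityMeasure μ] {V : Set E} (hV : MeasurableSet V) (hμV : μ Vᶜ = 0) {n : ℕ}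
    (hn : 0 < n) {f : ι → E → ℝ} (hf : ∀ j, Measurable (f j)) (hf1 : ∀ j x, |f j x| ≤ 1) {m δ : ℝ}
    (hm : 0 < m) (hδ : 0 ≤ δ) (hmean : ∀ j, m ≤ ∫ x, f j x ∂μ) (hnδ : Fintype.card ι ≤ δ * (n * m ^ 2)) :
    ∃ G : Set (Fin n → E), MeasurableSet G ∧
      ENNReal.ofReal (1 - δ) ≤ (Measure.pi fun _ : Fin n => μ) G ∧
      ∀ X ∈ G, (∀ i, X i ∈ V) ∧ ∀ j, 0 < ∑ i, f j (X i) := by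
  have hn' : (0 : ℝ) < n := by exact_mod_cast hn
  have hms : ∀ j, MeasurableSet {X : Fin n → E | ∑ i, f j (X i) ≤ 0} := fun j =>
    measurableSet_le (Finset.measurable_sum _ fun i _ => (hf j).comp (measurable_pi_apply i))
      measurable_const
  set B : Set (Fin n → E) := (⋃ i, (fun X => X i) ⁻¹' Vᶜ) ∪ ⋃ j, {X | ∑ i, f j (X i) ≤ 0} with hB
  have hBm : MeasurableSet B :=
    (MeasurableSet.iUnion fun i => measurable_pi_apply i hV.compl).union (MeasurableSet.iUnion hms)
  have hBle : (Measure.pi fun _ : Fin n => μ) B ≤ ENNReal.ofReal δ := by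
    refine (measure_union_le _ _).trans ?_
    have h1 : (Measure.pi fun _ : Fin n => μ) (⋃ i, (fun X => X i) ⁻¹' Vᶜ) = 0 := by
      refine measure_iUnion_null fun i => ?_
      exact ((measurePreserving_eval (fun _ : Fin n => μ) i).measure_preimage
        hV.compl.nullMeasurableSet).trans hμV
    rw [h1, zero_add]
    refine (measure_iUnion_fintype_le _ _).trans ?_
    refine (Finset.sum_le_sum fun j _ => pi_sum_nonpos_le μ hn (hf j) (hf1 j) hm (hmean j)).trans ?_
    rw [Finset.sum_const, Finset.card_univ, nsmul_eq_mul, ← ENNReal.ofReal_natCast,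
      ← ENNReal.ofReal_mul (by positivity)]
    refine ENNReal.ofReal_le_ofReal ?_
    rw [mul_one_div, div_le_iff₀ (by positivity)]
    exact hnδ
  refine ⟨Bᶜ, hBm.compl, ?_, ?_⟩
  · rw [prob_compl_eq_one_sub hBm, ENNReal.ofReal_sub _ hδ, ENNReal.ofReal_one]
    exact tsub_le_tsub_left hBle _
  · intro X hX
    simp only [hB, Set.mem_compl_iff, Set.mem_union, Set.mem_iUnion, not_or, not_exists] at hX
    refine ⟨fun i => not_not.1 (hX.1 i), fun j => not_le.1 (hX.2 j)⟩

namespace IsReachManifold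

variable {D d : ℕ} {S : Set (Amb D)} {τ σ ρ : ℝ}

/-- With high probability, uniformly in `r`, all caps over coordinate directions receive a fixed
proportion of the samples in the region of interest. -/
theorem exists_sampling_event (hS : IsReachManifold d S τ) (hσ : 0 < σ) (hρ0 : 0 < ρ)
    (hρ : ρ ^ 2 = σ * τ) (hbig : 1536 * (D + 1) * σ ≤ ρ) {δ : ℝ} (hδ : 0 < δ) :
    ∃ N : ℕ, ∀ r a : Amb D, IsNearestPoint S r a → ‖r - a‖ < σ →
      ∀ n : ℕ, N < n → ∀ b : OrthonormalBasis (Fin d) ℝ (tangentSubspace S a),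
      ∃ G : Set (Fin n → Amb D), MeasurableSet G ∧
        ENNReal.ofReal (1 - δ) ≤ sampleLaw n S σ G ∧
        ∀ X ∈ G, (∀ i, X i ∈ Metric.thickening σ S) ∧ ∀ j, ∀ ε : ℝ, ε = 1 ∨ ε = -1 →
          capRatio d * (roi X r ρ).card <
            ∑ i ∈ roi X r ρ, (tubeCap d S σ ρ r a (ε • (b j : Amb D))).indicator 1 (X i) := by
  classical
  set V := Metric.thickening σ S with hV
  have hVo : IsOpen V := Metric.isOpen_thickening
  have hVm := hVo.measurableSet
  have hVne : V.Nonempty := hS.nonempty.mono (Metric.self_subset_thickening hσ S)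
  have hV0 : volume V ≠ 0 := (hVo.measure_pos volume hVne).ne'
  have hVtop : volume V ≠ ⊤ := (hS.compact.isBounded.thickening).measure_lt_top.ne
  set μ := ProbabilityTheory.cond volume V with hμ
  have hprob : IsProbabilityMeasure μ := ProbabilityTheory.cond_isProbabilityMeasure_of_finite hV0 hVtop
  have hμV : μ Vᶜ = 0 := by
    rw [hμ, ProbabilityTheory.cond_apply hVm, Set.inter_compl_self, measure_empty, mul_zero]
  have hcap := capRatio_pos d
  have hcap1 := capRatio_le d
  -- A lower bound for the mass of the region of interest that does not depend on `r`: the region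
  -- contains the ball of radius `σ/2` about the midpoint of `r` and its foot. This makes `N`
  -- uniform in `r`.
  set m₀ : ℝ := ((volume V)⁻¹ * volume (Metric.ball (0 : Amb D) (σ / 2))).toReal with hm₀
  have hm₀pos : 0 < m₀ := by
    refine ENNReal.toReal_pos (mul_ne_zero (ENNReal.inv_ne_zero.2 hVtop) ?_)
      (ENNReal.mul_ne_top (ENNReal.inv_ne_top.2 hV0) measure_ball_lt_top.ne)
    exact (Metric.measure_ball_pos volume _ (half_pos hσ)).ne'
  obtain ⟨N, hN⟩ := exists_nat_gt ((d + d : ℝ) / (δ * (capRatio d * m₀) ^ 2))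
  refine ⟨N, fun r a hra hr n hn b => ?_⟩
  set U := V ∩ Metric.ball r ρ with hU
  have hUm : MeasurableSet U := (hVo.inter Metric.isOpen_ball).measurableSet
  have hσρ : σ ≤ ρ := by
    have : (0 : ℝ) ≤ D := D.cast_nonneg
    nlinarith
  have hμU : m₀ ≤ μ.real U := by
    rw [hm₀, Measure.real]
    refine ENNReal.toReal_mono (measure_ne_top _ _) ?_
    rw [hμ, ProbabilityTheory.cond_apply hVm, ← Measure.addHaar_ball_center volume (midpoint ℝ r a)]
    refine mul_le_mul_right (measure_mono fun x hx => ?_) _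
    rw [Metric.mem_ball] at hx
    rw [← dist_eq_norm] at hr
    have h1 := dist_triangle x (midpoint ℝ r a) a
    have h2 := dist_triangle x (midpoint ℝ r a) r
    rw [dist_midpoint_right, Real.norm_ofNat] at h1
    rw [dist_midpoint_left, Real.norm_ofNat] at h2
    refine ⟨Metric.mem_thickening_iff.2 ⟨a, hra.1, by linarith⟩,
      Metric.mem_thickening_iff.2 ⟨a, hra.1, by linarith⟩, ?_⟩
    rw [Metric.mem_ball]
    linarith
  -- Summed over samples in the tube, this is the cap count minus `capRatio d` times the size of the
  -- region of interest. Its mean is at least `capRatio d * m₀`, by the factor `2` in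
  -- `volume_tubeCap_ge`.
  let F : Amb D → Amb D → ℝ := fun e x =>
    (tubeCap d S σ ρ r a e).indicator 1 x - capRatio d * U.indicator 1 x
  have hcapm : ∀ e, MeasurableSet (tubeCap d S σ ρ r a e) := fun e =>
    (isOpen_tubeCap d S σ ρ r a e).measurableSet
  have hFm : ∀ e, Measurable (F e) := fun e =>
    (measurable_one.indicator (hcapm e)).sub ((measurable_one.indicator hUm).const_mul _)
  have hF1 : ∀ e x, |F e x| ≤ 1 := by
    intro e x
    simp only [F, Set.indicator_apply, Pi.one_apply]
    rw [abs_le]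
    split_ifs <;> constructor <;> linarith
  have hFint : ∀ e ∈ tangentSubspace S a, ‖e‖ = 1 → capRatio d * m₀ ≤ ∫ x, F e x ∂μ := by
    intro e he he1
    have h1 : ∫ x, F e x ∂μ = μ.real (tubeCap d S σ ρ r a e) - capRatio d * μ.real U := by
      have hi1 : Integrable ((tubeCap d S σ ρ r a e).indicator (1 : Amb D → ℝ)) μ :=
        (integrable_const (1 : ℝ)).indicator (hcapm e)
      have hi2 : Integrable (U.indicator (1 : Amb D → ℝ)) μ :=
        (integrable_const (1 : ℝ)).indicator hUm
      change ∫ x, (tubeCap d S σ ρ r a e).indicator 1 x - capRatio d * U.indicator 1 x ∂μ = _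
      rw [integral_sub hi1 (hi2.const_mul _), integral_const_mul, integral_indicator_one (hcapm e),
        integral_indicator_one hUm]
    have h2 : 2 * capRatio d * μ.real U ≤ μ.real (tubeCap d S σ ρ r a e) := by
      have h := hS.volume_tubeCap_ge hσ hρ0 hρ hbig hra hr he he1
      have h' : ENNReal.ofReal (2 * capRatio d) * μ U ≤ μ (tubeCap d S σ ρ r a e) := by
        rw [hμ, ProbabilityTheory.cond_apply hVm, ProbabilityTheory.cond_apply hVm,
          mul_left_comm, hU, ← Set.inter_assoc, Set.inter_self,
          Set.inter_eq_self_of_subset_right (fun x hx => hx.1.1 : tubeCap d S σ ρ r a e ⊆ V)]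
        exact mul_le_mul_right h _
      have h3 := ENNReal.toReal_mono (measure_ne_top _ _) h'
      rwa [ENNReal.toReal_mul, ENNReal.toReal_ofReal (by positivity)] at h3
    rw [h1]
    have : capRatio d * m₀ ≤ capRatio d * μ.real U := by gcongr
    linarith
  have hmem : ∀ j, (b j : Amb D) ∈ tangentSubspace S a := fun j => (b j).2
  have hnorm : ∀ j, ‖(b j : Amb D)‖ = 1 := fun j => b.orthonormal.1 j
  obtain ⟨G, hGm, hGδ, hG⟩ := exists_event_sum_pos μ hVm hμV (n := n) (by omega)
    (ι := Fin d ⊕ Fin d)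
    (f := Sum.elim (fun j => F ((1 : ℝ) • (b j : Amb D))) fun j => F ((-1 : ℝ) • (b j : Amb D)))
    (m := capRatio d * m₀) (δ := δ)
    (by rintro (j | j) <;> exact hFm _) (by rintro (j | j) <;> exact hF1 _)
    (by positivity) hδ.le
    (by
      rintro (j | j)
      · exact hFint _ (Submodule.smul_mem _ _ (hmem j)) (by simp [hnorm j])
      · exact hFint _ (Submodule.smul_mem _ _ (hmem j)) (by rw [norm_smul, hnorm j]; simp))
    (by
      rw [Fintype.card_sum, Fintype.card_fin]
      push_cast
      rw [div_lt_iff₀ (by positivity)] at hN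
      have : (N : ℝ) ≤ n := by exact_mod_cast hn.le
      calc (d + d : ℝ) ≤ N * (δ * (capRatio d * m₀) ^ 2) := hN.le
        _ ≤ n * (δ * (capRatio d * m₀) ^ 2) := by gcongr
        _ = _ := by ring)
  refine ⟨G, hGm, hGδ, fun X hX => ⟨(hG X hX).1, ?_⟩⟩
  have hsum : ∀ e, ∑ i, F e (X i) = ∑ i ∈ roi X r ρ, (tubeCap d S σ ρ r a e).indicator 1 (X i)
      - capRatio d * (roi X r ρ).card := by
    intro e
    rw [Finset.sum_sub_distrib, ← Finset.mul_sum]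
    congr 1
    · refine (Finset.sum_subset (Finset.subset_univ _) fun i _ hi => ?_).symm
      refine Set.indicator_of_notMem (fun hc => hi ?_) _
      simpa [roi] using hc.1.2
    · congr 1
      rw [roi, Finset.card_filter]
      push_cast
      refine Finset.sum_congr rfl fun i _ => ?_
      have := (hG X hX).1 i
      simp [Set.indicator_apply, hU, this]
  rintro j ε (rfl | rfl)
  · have := (hG X hX).2 (Sum.inl j)
    simp only [Sum.elim_inl, hsum] at this
    linarith
  · have := (hG X hX).2 (Sum.inr j)
    simp only [Sum.elim_inr, hsum] at this
    linarith

end IsReachManifold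

/-! ### Principal angles and orthogonal projections. -/

section

variable {D : ℕ}

namespace IsPrincipalPairs

variable {m : ℕ} {U W : Submodule ℝ (Amb D)} {u w : Fin m → Amb D}

theorem symm (h : IsPrincipalPairs U W u w) : IsPrincipalPairs W U w u where
  left_mem := h.right_mem
  right_mem := h.left_mem
  left_norm := h.right_norm
  right_norm := h.left_norm
  left_orthogonal := h.right_orthogonal
  right_orthogonal := h.left_orthogonal
  minimal i x hx y hy hx1 hy1 hxo hyo := by
    rw [real_inner_comm, real_inner_comm y x]
    exact h.minimal i y hy x hx hy1 hx1 hyo hxo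

theorem abs_inner_le (h : IsPrincipalPairs U W u w) (i : Fin m) {z : Amb D} (hz : z ∈ W)
    (hzo : ∀ j, j < i → inner ℝ (w j) z = 0) :
    |inner ℝ (u i) z| ≤ |inner ℝ (u i) (w i)| * ‖z‖ := by
  rcases eq_or_ne z 0 with rfl | h0
  · simp
  have hn : 0 < ‖z‖ := norm_pos_iff.2 h0
  have hmin := h.minimal i (u i) (h.left_mem i) (‖z‖⁻¹ • z) (W.smul_mem _ hz) (h.left_norm i)
    (by rw [norm_smul, norm_inv, norm_norm, inv_mul_cancel₀ hn.ne'])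
    (fun j hj => h.left_orthogonal i j hj)
    (fun j hj => by rw [real_inner_smul_right, hzo j hj, mul_zero])
  have hle : |inner ℝ (u i) (w i)| ≤ 1 := by
    simpa [h.left_norm, h.right_norm] using abs_real_inner_le_norm (u i) (w i)
  have hzle : |inner ℝ (u i) (‖z‖⁻¹ • z)| ≤ |inner ℝ (u i) (w i)| := by
    by_contra! hlt
    refine absurd hmin (not_le.2 (Real.arccos_lt_arccos ?_ hlt ?_))
    · linarith [abs_nonneg (inner ℝ (u i) (w i))]
    · refine (abs_real_inner_le_norm _ _).trans ?_
      rw [h.left_norm, norm_smul, norm_inv, norm_norm, inv_mul_cancel₀ hn.ne', mul_one]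
  rwa [real_inner_smul_right, abs_mul, abs_of_pos (inv_pos.2 hn), inv_mul_le_iff₀ hn,
    mul_comm] at hzle

/-- Stationarity of a minimal pair: perturbing `w i` to `w i + l • z` must not enlarge the cosine.
The competitor has to be orthogonal to the earlier `w j`, so those components are removed from `y`;
this leaves `⟪u i, y⟫` unchanged because `u i ⊥ w j`. -/
theorem inner_left_eq_zero_of_forall_lt (h : IsPrincipalPairs U W u w) (i : Fin m)
    (hlt : ∀ j, j < i → ∀ x ∈ U, inner ℝ (u j) x = 0 → inner ℝ x (w j) = 0)
    {y : Amb D} (hy : y ∈ W) (hyi : inner ℝ (w i) y = 0) : inner ℝ (u i) y = 0 := by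
  classical
  have horth : ∀ j k, j ≠ k → inner ℝ (w j) (w k) = 0 := by
    intro j k hjk
    rcases lt_or_gt_of_ne hjk with hl | hl
    · exact h.right_orthogonal k j hl
    · rw [real_inner_comm]; exact h.right_orthogonal j k hl
  set z := y - ∑ j ∈ Finset.univ.filter (· < i), inner ℝ (w j) y • w j with hz
  have hzW : z ∈ W := W.sub_mem hy (W.sum_mem fun j _ => W.smul_mem _ (h.right_mem j))
  have hzj : ∀ j, j < i → inner ℝ (w j) z = 0 := by
    intro j hj
    rw [hz, inner_sub_right, inner_sum, Finset.sum_eq_single j]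
    · rw [real_inner_smul_right, real_inner_self_eq_norm_sq, h.right_norm]; ring
    · intro k _ hk
      rw [real_inner_smul_right, horth j k hk.symm, mul_zero]
    · intro hn
      exact absurd (by simpa using hj) hn
  have hzi : inner ℝ (w i) z = 0 := by
    rw [hz, inner_sub_right, inner_sum, hyi, Finset.sum_eq_zero, sub_zero]
    intro k hk
    rw [real_inner_smul_right, horth i k (Finset.mem_filter.1 hk).2.ne', mul_zero]
  have huz : inner ℝ (u i) z = inner ℝ (u i) y := by
    rw [hz, inner_sub_right, inner_sum, Finset.sum_eq_zero, sub_zero]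
    intro k hk
    have hk' := (Finset.mem_filter.1 hk).2
    rw [real_inner_smul_right, hlt k hk' _ (h.left_mem i) (h.left_orthogonal i k hk'), mul_zero]
  rw [← huz]
  set s := inner ℝ (u i) (w i) with hs
  set b := inner ℝ (u i) z with hb
  have hquad : ∀ l : ℝ, (s + l * b) ^ 2 ≤ s ^ 2 * (1 + l ^ 2 * ‖z‖ ^ 2) := by
    intro l
    have h1 := h.abs_inner_le i (W.add_mem (h.right_mem i) (W.smul_mem l hzW)) (fun j hj => by
      rw [inner_add_right, real_inner_smul_right, hzj j hj, h.right_orthogonal i j hj]; ring)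
    rw [inner_add_right, real_inner_smul_right] at h1
    have h2 : ‖w i + l • z‖ ^ 2 = 1 + l ^ 2 * ‖z‖ ^ 2 := by
      rw [norm_add_sq_real, h.right_norm, real_inner_smul_right, hzi, norm_smul, mul_pow,
        Real.norm_eq_abs, sq_abs]
      ring
    rw [← h2, ← sq_abs (s + l * b), ← sq_abs s, ← mul_pow]
    gcongr
  by_contra hne
  have hb2 : 0 < b ^ 2 := by positivity
  rcases eq_or_ne s 0 with h0 | h0
  · have := hquad 1
    rw [h0] at this
    nlinarith
  · have hs2 : 0 < s ^ 2 := by positivity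
    -- A step `l = e * s * b` small enough that the linear gain `2lsb` beats the quadratic loss
    -- `s²l²‖z‖²`. The case `s = 0` has no linear term and was treated with `l = 1`.
    set e := 1 / (s ^ 2 * ‖z‖ ^ 2 + 1) with he
    have he0 : 0 < e := by positivity
    have he1 : e * (s ^ 2 * ‖z‖ ^ 2 + 1) = 1 := by rw [he]; field_simp
    have := hquad (e * s * b)
    have hp : 0 < e * (s ^ 2 * b ^ 2) := by positivity
    have h3 : e * (s ^ 2 * b ^ 2) * (2 + e * b ^ 2) ≤ e * (s ^ 2 * b ^ 2) * (e * (s ^ 2 * ‖z‖ ^ 2)) := by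
      nlinarith
    have h4 := le_of_mul_le_mul_left h3 hp
    have h5 : 0 < e * b ^ 2 := by positivity
    nlinarith

theorem inner_left_eq_zero (h : IsPrincipalPairs U W u w) (i : Fin m) :
    (∀ y ∈ W, inner ℝ (w i) y = 0 → inner ℝ (u i) y = 0) ∧
      ∀ x ∈ U, inner ℝ (u i) x = 0 → inner ℝ x (w i) = 0 := by
  induction i using WellFoundedLT.induction with
  | ind i ih =>
    refine ⟨fun y hy hyi => h.inner_left_eq_zero_of_forall_lt i (fun j hj => (ih j hj).2) hy hyi,
      fun x hx hxi => ?_⟩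
    rw [real_inner_comm]
    refine h.symm.inner_left_eq_zero_of_forall_lt i (fun j hj y hy hyj => ?_) hx hxi
    rw [real_inner_comm]
    exact (ih j hj).1 y hy hyj

/-- By stationarity the projection of `w i` to `U` is a multiple of `u i`. Hence the sine of every
principal angle, not only the first, is the distance of `w i` from `U`. -/
theorem inner_sq_eq (h : IsPrincipalPairs U W u w) (i : Fin m) :
    inner ℝ (u i) (w i) ^ 2 = 1 - ‖Uᗮ.starProjection (w i)‖ ^ 2 := by
  set s := inner ℝ (u i) (w i) with hs
  have h1 : inner ℝ (U.starProjection (w i)) (w i) = ‖U.starProjection (w i)‖ ^ 2 := by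
    simpa using U.re_inner_starProjection_eq_normSq (w i)
  have h2 : inner ℝ (u i) (U.starProjection (w i)) = s := by
    rw [← U.inner_starProjection_left_eq_right, (U.starProjection_eq_self_iff).2 (h.left_mem i)]
  have h3 := (h.inner_left_eq_zero i).2 (U.starProjection (w i) - s • u i)
    (U.sub_mem (U.starProjection_apply_mem _) (U.smul_mem _ (h.left_mem i))) (by
      rw [inner_sub_right, h2, real_inner_smul_right, real_inner_self_eq_norm_sq, h.left_norm]; ring)
  rw [inner_sub_left, real_inner_smul_left, h1, ← hs] at h3
  have h4 := U.norm_sq_eq_add_norm_sq_starProjection (w i)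
  rw [h.right_norm] at h4
  linarith

end IsPrincipalPairs

/-- Each sine is at most `ε`, and `θ ≤ (π/2) sin θ ≤ 2 sin θ` on `[0, π/2]`. -/
theorem maxPrincipalAngle_le {U W : Submodule ℝ (Amb D)} {ε : ℝ} (hε : 0 ≤ ε)
    (h : ∀ w ∈ W, ‖w‖ = 1 → ‖Uᗮ.starProjection w‖ ≤ ε) : maxPrincipalAngle U W ≤ 2 * ε := by
  refine Real.sSup_le ?_ (by positivity)
  rintro β ⟨u, w, hp, i, rfl⟩
  have h1 := hp.inner_sq_eq i
  have h2 := h _ (hp.right_mem i) (hp.right_norm i)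
  set θ := Real.arccos |inner ℝ (u i) (w i)| with hθ
  have hsin : Real.sin θ ≤ ε := by
    rw [hθ, Real.sin_arccos, sq_abs, h1, sub_sub_cancel, Real.sqrt_sq (norm_nonneg _)]
    exact h2
  have h3 := Real.mul_le_sin (Real.arccos_nonneg |inner ℝ (u i) (w i)|) (Real.arccos_le_pi_div_two.2 (abs_nonneg _))
  rw [← hθ] at h3
  have hpi := Real.pi_pos
  have h4 : θ = Real.pi / 2 * (2 / Real.pi * θ) := by field_simp
  have h5 := Real.pi_le_four
  calc θ = Real.pi / 2 * (2 / Real.pi * θ) := h4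
    _ ≤ Real.pi / 2 * ε := by gcongr; exact h3.trans hsin
    _ ≤ 2 * ε := by gcongr; linarith

theorem abs_inner_le_infDist_mul (H : Submodule ℝ (Amb D)) {v : Amb D} (hv : v ∈ Hᗮ) (y : Amb D) :
    |inner ℝ y v| ≤ Metric.infDist y (H : Set (Amb D)) * ‖v‖ := by
  rcases eq_or_ne v 0 with rfl | h0
  · simp
  have hn : 0 < ‖v‖ := norm_pos_iff.2 h0
  rw [← div_le_iff₀ hn, Metric.le_infDist ⟨0, H.zero_mem⟩]
  intro h hh
  rw [div_le_iff₀ hn, dist_eq_norm]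
  refine le_trans (le_of_eq ?_) (abs_real_inner_le_norm (y - h) v)
  rw [inner_sub_left, (Submodule.mem_orthogonal _ _).1 hv h hh, sub_zero]

/-- A vector has a large coordinate in any orthonormal basis. -/
theorem exists_norm_le_abs_inner {d : ℕ} {T : Submodule ℝ (Amb D)}
    (b : OrthonormalBasis (Fin d) ℝ T) {u : Amb D} (hu : u ∈ T) (h0 : u ≠ 0) :
    ∃ j, ‖u‖ ≤ (d + 1) * |inner ℝ (b j : Amb D) u| := by
  by_contra! hc
  have hn : 0 < ‖u‖ := norm_pos_iff.2 h0
  have h1 : ‖u‖ ≤ ∑ j, |inner ℝ (b j : Amb D) u| := by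
    have hs := b.sum_repr' ⟨u, hu⟩
    have hs' : ∑ j, inner ℝ (b j : Amb D) u • (b j : Amb D) = u := by
      simpa using congrArg (Subtype.val) hs
    nth_rw 1 [← hs']
    refine (norm_sum_le _ _).trans (Finset.sum_le_sum fun j _ => ?_)
    rw [norm_smul, show ‖(b j : Amb D)‖ = 1 from b.orthonormal.1 j, mul_one, Real.norm_eq_abs]
  have h2 : (d + 1) * ∑ j, |inner ℝ (b j : Amb D) u| ≤ d * ‖u‖ := by
    rw [Finset.mul_sum]
    calc _ ≤ ∑ _j : Fin d, ‖u‖ := Finset.sum_le_sum fun j _ => (hc j).le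
      _ = _ := by simp
  have h3 : ((d : ℝ) + 1) * ‖u‖ ≤ (d + 1) * ∑ j, |inner ℝ (b j : Amb D) u| := by gcongr
  linarith

end

/-! ### Tilt of a well fitting plane. -/

section

variable {D d : ℕ} {S : Set (Amb D)} {τ σ ρ : ℝ}

theorem J₁_le_of_forall {n : ℕ} {X : Fin n → Amb D} {r q : Amb D} {H : Submodule ℝ (Amb D)} {A : ℝ}
    (hA : 0 ≤ A) (h : ∀ i ∈ roi X r ρ, Metric.infDist (X i - q) (H : Set (Amb D)) ^ 2 ≤ A) :
    J₁ X ρ r q H ≤ A := by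
  rw [J₁, one_div]
  have h1 := Finset.sum_le_card_nsmul _ _ _ h
  rw [nsmul_eq_mul] at h1
  rcases ((roi X r ρ).card.cast_nonneg (α := ℝ)).eq_or_lt with h0 | h0
  · rw [← h0, inv_zero, zero_mul]; exact hA
  · rwa [inv_mul_le_iff₀ h0]

theorem sum_infDist_sq_eq {n : ℕ} (X : Fin n → Amb D) (r q : Amb D) (H : Submodule ℝ (Amb D)) :
    ∑ i ∈ roi X r ρ, Metric.infDist (X i - q) (H : Set (Amb D)) ^ 2
      = (roi X r ρ).card * J₁ X ρ r q H := by
  rw [J₁]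
  rcases (roi X r ρ).eq_empty_or_nonempty with h0 | h0
  · simp [h0]
  · have : ((roi X r ρ).card : ℝ) ≠ 0 := by
      exact_mod_cast h0.card_pos.ne'
    field_simp

/-- The constant bounding the distance of the optimal subspace from the tangent space. -/
noncomputable def slopeConst (d : ℕ) : ℝ := 40 * (d + 1) / Real.sqrt (capRatio d)

theorem slopeConst_pos (d : ℕ) : 0 < slopeConst d := by
  have := capRatio_pos d
  unfold slopeConst
  positivity

namespace IsReachManifold

theorem norm_normal_sub_le (hS : IsReachManifold d S τ) (hσρ : 2 * σ ≤ ρ)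
    (hρ : ρ ^ 2 = σ * τ) {r a x : Amb D} (ha : a ∈ S) (hr : ‖r - a‖ < σ)
    (hx : x ∈ Metric.thickening σ S) (hxr : ‖x - r‖ < ρ) :
    ‖(tangentSubspace S a)ᗮ.starProjection (x - a)‖ ≤ 3 * σ := by
  have hτ := hS.pos
  have hσ : 0 < σ := (norm_nonneg _).trans_lt hr
  set T := tangentSubspace S a
  obtain ⟨c, hc, hxc⟩ := Metric.mem_thickening_iff.1 hx
  rw [dist_eq_norm] at hxc
  have hca : ‖c - a‖ ≤ 2 * ρ := by
    have : c - a = -(x - c) + ((x - r) + (r - a)) := by abel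
    rw [this]
    refine (norm_add_le _ _).trans ?_
    rw [norm_neg]
    have := norm_add_le (x - r) (r - a)
    linarith
  have h1 : ‖Tᗮ.starProjection (c - a)‖ ≤ 2 * σ := by
    refine norm_starProjection_le_of_inner _ (by positivity) fun ν hν => ?_
    rw [real_inner_comm]
    refine (hS.abs_inner_le ha hc hν).trans ?_
    gcongr
    rw [div_le_iff₀ (by positivity)]
    have : ‖c - a‖ ^ 2 ≤ (2 * ρ) ^ 2 := by gcongr
    nlinarith
  rw [show x - a = (x - c) + (c - a) by abel, map_add]
  refine (norm_add_le _ _).trans ?_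
  have := (Tᗮ.norm_starProjection_apply_le (x - c))
  linarith

/-- Minimisers have small functional, since the tangent plane at the foot of `r` competes. -/
theorem minimiser_J₁_le (hS : IsReachManifold d S τ) (hσρ : 2 * σ ≤ ρ)
    (hρ : ρ ^ 2 = σ * τ) {n : ℕ} {X : Fin n → Amb D} {r a q : Amb D} {H : Submodule ℝ (Amb D)}
    (hra : IsNearestPoint S r a) (hr : ‖r - a‖ < σ)
    (hX : ∀ i, X i ∈ Metric.thickening σ S)
    (hmin : ∀ q' H', IsAdmissible d σ r q' H' → J₁ X ρ r q H ≤ J₁ X ρ r q' H') :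
    J₁ X ρ r q H ≤ 9 * σ ^ 2 := by
  obtain ⟨ch⟩ := hS.chart a hra.1
  have hσ : 0 < σ := (norm_nonneg _).trans_lt hr
  set T := tangentSubspace S a
  refine (hmin a T ⟨ch.finrank_tangentSubspace hra.1, hra.sub_mem_orthogonal, by linarith⟩).trans ?_
  refine J₁_le_of_forall (by positivity) fun i hi => ?_
  have hir : ‖X i - r‖ < ρ := by
    rw [← dist_eq_norm]
    simpa [roi] using hi
  have h1 := hS.norm_normal_sub_le hσρ hρ hra.1 hr (hX i) hir
  have h2 : Metric.infDist (X i - a) (T : Set (Amb D)) ≤ 3 * σ := by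
    refine (Metric.infDist_le_dist_of_mem (T.starProjection_apply_mem (X i - a))).trans ?_
    rwa [dist_eq_norm, ← Submodule.starProjection_orthogonal_val]
  calc _ ≤ (3 * σ) ^ 2 := by
        have := Metric.infDist_nonneg (x := X i - a) (s := (T : Set (Amb D)))
        gcongr
    _ = _ := by ring

/-- Vectors normal to a well fitting subspace are almost normal to the manifold. -/
theorem norm_tangent_part_le (hS : IsReachManifold d S τ) (hσρ : 2 * σ ≤ ρ)
    (hρ : ρ ^ 2 = σ * τ) {n : ℕ} {X : Fin n → Amb D} {r a q : Amb D} {H : Submodule ℝ (Amb D)}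
    (ha : a ∈ S) (hr : ‖r - a‖ < σ) (hrq : ‖r - q‖ < 2 * σ)
    (hX : ∀ i, X i ∈ Metric.thickening σ S) (hJ : J₁ X ρ r q H ≤ 9 * σ ^ 2)
    (b : OrthonormalBasis (Fin d) ℝ (tangentSubspace S a))
    (hcount : ∀ j, ∀ ε : ℝ, ε = 1 ∨ ε = -1 → capRatio d * (roi X r ρ).card <
      ∑ i ∈ roi X r ρ, (tubeCap d S σ ρ r a (ε • (b j : Amb D))).indicator 1 (X i))
    {v : Amb D} (hv : v ∈ Hᗮ) :
    ‖(tangentSubspace S a).starProjection v‖ ≤ slopeConst d * (σ / ρ) * ‖v‖ := by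
  have hσ : 0 < σ := (norm_nonneg _).trans_lt hr
  have hρ0 : 0 < ρ := by linarith
  have hcap := capRatio_pos d
  have hK := slopeConst_pos d
  set u := (tangentSubspace S a).starProjection v with hu
  have huT : u ∈ tangentSubspace S a := (tangentSubspace S a).starProjection_apply_mem v
  rcases eq_or_ne u 0 with h0 | h0
  · rw [h0, norm_zero]; positivity
  have hun : 0 < ‖u‖ := norm_pos_iff.2 h0
  obtain ⟨j, hj⟩ := exists_norm_le_abs_inner b huT h0
  set β := inner ℝ (a - q) u with hβ
  set θ := inner ℝ (b j : Amb D) u with hθ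
  -- Choose the cap on the side where the offset `β` of the base points has the sign of `ε * θ`, so
  -- that the two cannot cancel.
  obtain ⟨ε, hε, hεs⟩ : ∃ ε : ℝ, (ε = 1 ∨ ε = -1) ∧ 0 ≤ ε * θ * β := by
    rcases le_total 0 (θ * β) with h | h
    · exact ⟨1, Or.inl rfl, by linarith⟩
    · exact ⟨-1, Or.inr rfl, by linarith⟩
  have hε2 : |ε| = 1 := by rcases hε with rfl | rfl <;> simp
  set N : ℝ := ((roi X r ρ).card : ℝ) with hN
  have hc := hcount j ε hε
  set L := ρ * ‖u‖ / (4 * (d + 1)) with hL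
  have hL0 : 0 < L := by positivity
  have hlow : ∀ x ∈ tubeCap d S σ ρ r a (ε • (b j : Amb D)), L ^ 2 ≤ inner ℝ (x - q) u ^ 2 := by
    intro x hx
    have hx2 : ‖(tangentSubspace S a).starProjection (x - a) - (ρ / 2) • ε • (b j : Amb D)‖ < ρ / (8 * (d + 1)) := hx.2
    set w := (tangentSubspace S a).starProjection (x - a) - (ρ / 2) • ε • (b j : Amb D) with hw
    have h1 : inner ℝ (x - q) u = inner ℝ w u + (ρ / 2 * (ε * θ) + β) := by
      have e1 : inner ℝ ((tangentSubspace S a).starProjection (x - a)) u = inner ℝ (x - a) u := by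
        rw [(tangentSubspace S a).inner_starProjection_left_eq_right, ((tangentSubspace S a).starProjection_eq_self_iff).2 huT]
      rw [show x - q = (x - a) + (a - q) by abel, inner_add_left, hw,
        inner_sub_left ((tangentSubspace S a).starProjection (x - a)), e1,
        real_inner_smul_left, real_inner_smul_left]
      ring
    have h2 : |inner ℝ w u| ≤ ρ / (8 * (d + 1)) * ‖u‖ :=
      (abs_real_inner_le_norm _ _).trans (by gcongr)
    have h3 : ρ / 2 * |θ| ≤ |ρ / 2 * (ε * θ) + β| := by
      have e1 : ρ / 2 * |θ| = |ρ / 2 * (ε * θ)| := by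
        rw [abs_mul, abs_mul, hε2, one_mul, abs_of_pos (half_pos hρ0)]
      rw [e1]
      refine sq_le_sq.1 ?_
      have : 0 ≤ ρ / 2 * (ε * θ * β) := by positivity
      nlinarith [sq_nonneg β]
    have h4 : ρ / 2 * (‖u‖ / (d + 1)) ≤ ρ / 2 * |θ| := by
      gcongr
      rw [div_le_iff₀ (by positivity)]
      linarith
    have h5 : L ≤ |inner ℝ (x - q) u| := by
      rw [h1]
      have := abs_sub_abs_le_abs_sub (ρ / 2 * (ε * θ) + β) (-inner ℝ w u)
      rw [abs_neg, sub_neg_eq_add, add_comm (ρ / 2 * (ε * θ) + β)] at this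
      have e1 : L = 1 / 4 * (ρ * ‖u‖ / (d + 1)) := by rw [hL]; field_simp
      have e2 : ρ / (8 * (d + 1)) * ‖u‖ = 1 / 8 * (ρ * ‖u‖ / (d + 1)) := by field_simp
      have e3 : ρ / 2 * (‖u‖ / (d + 1)) = 1 / 2 * (ρ * ‖u‖ / (d + 1)) := by field_simp
      have e4 : 0 ≤ ρ * ‖u‖ / (d + 1) := by positivity
      linarith
    rw [← sq_abs (inner ℝ (x - q) u)]
    gcongr
  have hupp : ∀ i ∈ roi X r ρ, inner ℝ (X i - q) u ^ 2 ≤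
      2 * ‖v‖ ^ 2 * Metric.infDist (X i - q) (H : Set (Amb D)) ^ 2 + 72 * σ ^ 2 * ‖v‖ ^ 2 := by
    intro i hi
    have hir : ‖X i - r‖ < ρ := by
      rw [← dist_eq_norm]
      simpa [roi] using hi
    have h1 := hS.norm_normal_sub_le hσρ hρ ha hr (hX i) hir
    have h2 : ‖(tangentSubspace S a)ᗮ.starProjection (X i - q)‖ ≤ 6 * σ := by
      rw [show X i - q = (X i - a) + ((r - q) - (r - a)) by abel, map_add]
      refine (norm_add_le _ _).trans ?_
      have e1 := (tangentSubspace S a)ᗮ.norm_starProjection_apply_le ((r - q) - (r - a))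
      have e2 := norm_sub_le (r - q) (r - a)
      linarith
    have h3 : inner ℝ (X i - q) u
        = inner ℝ (X i - q) v - inner ℝ ((tangentSubspace S a)ᗮ.starProjection (X i - q)) v := by
      rw [(tangentSubspace S a)ᗮ.inner_starProjection_left_eq_right, ← inner_sub_right]
      congr 1
      have := (tangentSubspace S a).starProjection_add_starProjection_orthogonal v
      rw [hu]
      exact eq_sub_of_add_eq this
    have h4 := abs_inner_le_infDist_mul H hv (X i - q)
    have h5 : |inner ℝ ((tangentSubspace S a)ᗮ.starProjection (X i - q)) v| ≤ 6 * σ * ‖v‖ :=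
      (abs_real_inner_le_norm _ _).trans (by gcongr)
    have h6 := sq_le_sq' (abs_le.1 h4).1 (abs_le.1 h4).2
    have h7 := sq_le_sq' (abs_le.1 h5).1 (abs_le.1 h5).2
    rw [h3]
    nlinarith [sq_nonneg (inner ℝ (X i - q) v + inner ℝ ((tangentSubspace S a)ᗮ.starProjection (X i - q)) v)]
  -- Strictness in the count excludes an empty region of interest, where both sides would vanish.
  have hNpos : 0 < N := by
    rcases (roi X r ρ).eq_empty_or_nonempty with he | he
    · rw [hN, he] at hc
      simp at hc
    · rw [hN]
      exact_mod_cast he.card_pos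
  have hsum1 : L ^ 2 * (capRatio d * N) ≤ ∑ i ∈ roi X r ρ, inner ℝ (X i - q) u ^ 2 := by
    refine (mul_le_mul_of_nonneg_left hc.le (sq_nonneg L)).trans ?_
    rw [Finset.mul_sum]
    refine Finset.sum_le_sum fun i _ => ?_
    by_cases hi : X i ∈ tubeCap d S σ ρ r a (ε • (b j : Amb D))
    · rw [Set.indicator_of_mem hi, Pi.one_apply, mul_one]
      exact hlow _ hi
    · rw [Set.indicator_of_notMem hi, mul_zero]
      positivity
  -- Here `90 = 2 · 9 + 72`, with `72 = 2 · 6²` from the normal parts. Then `16 · 90 = 1440 ≤ 40²`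
  -- explains the `40` in `slopeConst`.
  have hsum2 : ∑ i ∈ roi X r ρ, inner ℝ (X i - q) u ^ 2 ≤ 90 * σ ^ 2 * ‖v‖ ^ 2 * N := by
    refine (Finset.sum_le_sum hupp).trans ?_
    rw [Finset.sum_add_distrib, ← Finset.mul_sum, sum_infDist_sq_eq, Finset.sum_const, nsmul_eq_mul,
      ← hN]
    have : 2 * ‖v‖ ^ 2 * (N * J₁ X ρ r q H) ≤ 2 * ‖v‖ ^ 2 * (N * (9 * σ ^ 2)) := by gcongr
    linarith
  have hfin : L ^ 2 * capRatio d ≤ 90 * σ ^ 2 * ‖v‖ ^ 2 := by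
    refine le_of_mul_le_mul_right ?_ hNpos
    linarith
  refine le_of_sq_le_sq ?_ (by positivity)
  have hsq : Real.sqrt (capRatio d) ^ 2 = capRatio d := Real.sq_sqrt hcap.le
  have e1 : (slopeConst d * (σ / ρ) * ‖v‖) ^ 2
      = 1600 * (d + 1) ^ 2 * (σ ^ 2 * ‖v‖ ^ 2) / (capRatio d * ρ ^ 2) := by
    rw [slopeConst, mul_pow, mul_pow, div_pow, div_pow, hsq]
    field_simp
    ring
  have e2 : L ^ 2 * capRatio d = capRatio d * ρ ^ 2 * ‖u‖ ^ 2 / (16 * (d + 1) ^ 2) := by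
    rw [hL]; field_simp; norm_num
  rw [e2, div_le_iff₀ (by positivity)] at hfin
  rw [e1, le_div_iff₀ (by positivity)]
  have : 0 ≤ ((d : ℝ) + 1) ^ 2 * (σ ^ 2 * ‖v‖ ^ 2) := by positivity
  linarith

end IsReachManifold

/-- Deterministic, and it needs only admissibility: `q` is within `2σ` of `r`, hence at distance
less than `3σ ≤ τ` from `S`. -/
theorem exists_isNearestPoint_of_admissible (hS : HasUniqueProjection S τ) (h3 : 3 * σ ≤ τ)
    {r q : Amb D} {H : Submodule ℝ (Amb D)} (hr : r ∈ Metric.thickening σ S)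
    (hq : IsAdmissible d σ r q H) :
    (∃! p, IsNearestPoint S q p) ∧ ∀ p, IsNearestPoint S q p → ‖p - q‖ ≤ 3 * σ := by
  have hlt : Metric.infDist q S < 3 * σ := by
    obtain ⟨c, hc, hrc⟩ := Metric.mem_thickening_iff.1 hr
    refine (Metric.infDist_le_dist_of_mem hc).trans_lt ?_
    have h1 := dist_triangle q r c
    have h2 := hq.2.2
    rw [← dist_eq_norm, dist_comm] at h2
    linarith
  refine ⟨hS.existsUnique q (hlt.trans_le h3), fun p hp => ?_⟩
  rw [← dist_eq_norm, dist_comm, hp.2]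
  exact hlt.le

end

/-! ### The theorem. -/

theorem theorem3p2 (d : ℕ) :
    ∃ C : ℝ, 0 < C ∧ ∀ D : ℕ, ∃ M₀ : ℝ, 0 < M₀ ∧
      ∀ (k : ℕ) (S : Set (Amb D)) (σ τ : ℝ),
        1 ≤ k → IsSubmanifold k d S → IsCompact S →
        0 < σ → reach S = ENNReal.ofReal τ → M₀ ≤ τ / σ →
        (∀ δ : ℝ, 0 < δ → ∃ N : ℕ, ∀ r ∈ Metric.thickening σ S, ∀ n : ℕ, N < n →
          ∃ G : Set (Fin n → Amb D), MeasurableSet G ∧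
            ENNReal.ofReal (1 - δ) ≤ sampleLaw n S σ G ∧
            ∀ X ∈ G, ∀ (q : Amb D) (H : Submodule ℝ (Amb D)), IsMinimiser d σ τ X r q H →
              ∀ p, IsNearestPoint S q p →
                maxPrincipalAngle H (tangentSubspace S p) ≤ Real.sqrt (C / (τ / σ))) ∧
        (∀ r ∈ Metric.thickening σ S, ∀ (n : ℕ) (X : Fin n → Amb D) (q : Amb D)
          (H : Submodule ℝ (Amb D)), IsMinimiser d σ τ X r q H →
            (∃! p, IsNearestPoint S q p) ∧ ∀ p, IsNearestPoint S q p → ‖p - q‖ ≤ 3 * σ) := by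
  have hK := slopeConst_pos d
  -- `slopeConst d` is the tilt of `H` against the tangent space at `a`, `48 = 8 · 6` the change
  -- from `a` to `p`, and `4` the square of the passage from sine to angle. In the threshold `1536 =
  -- 4 · 384`, so that `η = 384ρ/τ` satisfies `4(D+1)η ≤ 1`.
  refine ⟨4 * (slopeConst d + 48) ^ 2, by positivity, fun D => ⟨(1536 * (D + 1)) ^ 2, by positivity, ?_⟩⟩
  intro k S σ τ hk hsub hcomp hσ hreach hM
  have hD0 : (0 : ℝ) ≤ D := D.cast_nonneg
  have hM1 : (1536 : ℝ) ≤ τ / σ := by nlinarith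
  have hτ : 0 < τ := by
    by_contra h
    have := div_nonpos_of_nonpos_of_nonneg (not_lt.1 h) hσ.le
    linarith
  have hproj := hasUniqueProjection_of_reach hcomp hτ hreach
  have hS : IsReachManifold d S τ := ⟨hproj, fun p hp => hsub.nonempty_tangentChart hk hp⟩
  have h3 : 3 * σ ≤ τ := by
    rw [le_div_iff₀ hσ] at hM1
    linarith
  refine ⟨fun δ hδ => ?_, fun r hr n X q H hmin =>
    exists_isNearestPoint_of_admissible hproj h3 hr hmin.1⟩
  set ρ := Real.sqrt (σ * τ) with hρdef
  have hρ : ρ ^ 2 = σ * τ := Real.sq_sqrt (by positivity)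
  have hρ0 : 0 < ρ := Real.sqrt_pos.2 (by positivity)
  have hbig : 1536 * (D + 1) * σ ≤ ρ := by
    rw [le_div_iff₀ hσ] at hM
    refine Real.le_sqrt_of_sq_le ?_
    nlinarith
  have hσρ : 2 * σ ≤ ρ := by nlinarith
  obtain ⟨N, hN⟩ := hS.exists_sampling_event hσ hρ0 hρ hbig hδ
  refine ⟨N, fun r hr n hn => ?_⟩
  obtain ⟨a, hra⟩ := hcomp.exists_isNearestPoint hS.nonempty r
  have hr' : ‖r - a‖ < σ := by
    rw [← dist_eq_norm, hra.2]
    exact (Metric.mem_thickening_iff_infDist_lt hS.nonempty).1 hr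
  obtain ⟨ch⟩ := hS.chart a hra.1
  let b := (stdOrthonormalBasis ℝ (tangentSubspace S a)).reindex
    (finCongr (ch.finrank_tangentSubspace hra.1))
  obtain ⟨G, hGm, hGδ, hG⟩ := hN r a hra hr' n hn b
  refine ⟨G, hGm, hGδ, fun X hX q H hmin p hp => ?_⟩
  obtain ⟨hXV, hcount⟩ := hG X hX
  have hJ := hS.minimiser_J₁_le hσρ hρ hra hr' hXV hmin.2
  have hpq := (exists_isNearestPoint_of_admissible hproj h3 hr hmin.1).2 p hp
  have hpa : ‖p - a‖ ≤ 6 * σ := by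
    have e : p - a = (p - q) + ((r - a) - (r - q)) := by abel
    rw [e]
    refine (norm_add_le _ _).trans ?_
    have e1 := norm_sub_le (r - a) (r - q)
    have e2 := hmin.1.2.2
    linarith
  have hratio : σ / τ = (σ / ρ) ^ 2 := by
    rw [div_pow, hρ]; field_simp
  have hsmall : σ / ρ ≤ 1 := by rw [div_le_one hρ0]; linarith
  have hsq : Real.sqrt (4 * (slopeConst d + 48) ^ 2 / (τ / σ))
      = 2 * ((slopeConst d + 48) * (σ / ρ)) := by
    rw [← Real.sqrt_sq (show 0 ≤ 2 * ((slopeConst d + 48) * (σ / ρ)) by positivity)]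
    congr 1
    rw [div_div_eq_mul_div, mul_div_assoc, hratio]
    ring
  rw [hsq]
  refine maxPrincipalAngle_le (by positivity) fun w hw hw1 => ?_
  set v := Hᗮ.starProjection w with hv
  have hvH : v ∈ Hᗮ := Hᗮ.starProjection_apply_mem w
  have hTv := hS.norm_tangent_part_le hσρ hρ hra.1 hr' hmin.1.2.2 hXV hJ b hcount hvH
  have h1 : inner ℝ v w = ‖v‖ ^ 2 := by
    exact Hᗮ.re_inner_starProjection_eq_normSq w
  -- Split `v` along `T` and its complement at `a`: the first part is small because `v ⊥ H`, the
  -- second pairs weakly with `w` because `w` is tangent at the nearby point `p`. Dividing `‖v‖² =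
  -- ⟪v, w⟫` by `‖v‖` gives the bound.
  have h2 : inner ℝ v w = inner ℝ ((tangentSubspace S a).starProjection v) w + inner ℝ w ((tangentSubspace S a)ᗮ.starProjection v) := by
    rw [real_inner_comm ((tangentSubspace S a)ᗮ.starProjection v) w, ← inner_add_left,
      (tangentSubspace S a).starProjection_add_starProjection_orthogonal]
  have h3' : inner ℝ ((tangentSubspace S a).starProjection v) w ≤ slopeConst d * (σ / ρ) * ‖v‖ := by
    refine (real_inner_le_norm _ _).trans ?_
    rwa [hw1, mul_one]
  have h4 : inner ℝ w ((tangentSubspace S a)ᗮ.starProjection v) ≤ 48 * (σ / ρ) * ‖v‖ := by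
    refine (le_abs_self _).trans ((hS.abs_inner_tangent_normal_le hra.1 hp.1 hw
      ((tangentSubspace S a)ᗮ.starProjection_apply_mem v)).trans ?_)
    have e1 : 8 * ‖p - a‖ / τ ≤ 48 * (σ / ρ) := by
      calc 8 * ‖p - a‖ / τ ≤ 8 * (6 * σ) / τ := by gcongr
        _ = 48 * (σ / ρ) ^ 2 := by rw [← hratio]; ring
        _ ≤ 48 * (σ / ρ) := by
          have : 0 ≤ σ / ρ := by positivity
          nlinarith
    rw [hw1, one_mul]
    have e2 := (tangentSubspace S a)ᗮ.norm_starProjection_apply_le v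
    gcongr
  rcases (norm_nonneg v).eq_or_lt with h0 | h0
  · rw [← h0]; positivity
  · refine le_of_mul_le_mul_right ?_ h0
    nlinarith
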